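/- **Theorem (Channel observation, spherical ubiquitous array).** *Model.* A continuous spherical antenna array of radius $r_0>0$ is centred at the origin of $\mathbb{R}^3$; its element $A=(r_0,\varphi,\theta)$ has azimuth $\varphi$ and polar angle $\theta$. Let $\lambda>0$ be the wavelength and let $U$ users be located at $X_1,\dots,X_U\in\mathbb{R}^3$, each transmitting the pilot symbol $1$. The received training signal is $$q(\varphi,\theta)=q(A)=\frac{\lambda}{\sqrt{4\pi}}\sum_{u=1}^{U}\frac{e^{-j\frac{2\pi}{\lambda}|X_u-A|}}{\sqrt{4\pi}\,|X_u-A|}+z(A),$$ where the noise $z(A)$ at each element $A$ has law $\mathcal{CN}(0,\sigma^2)$ (circularly symmetric complex Gaussian) and $z(A),z(B)$ are independent whenever $A\ne B$. *Spherical harmonics.* For $\ell\ge 0$ and $-\ell\le m\le\ell$, $$Y_\ell^m(\varphi,\theta)=\sqrt{\tfrac{2\ell+1}{4\pi}\tfrac{(\ell-m)!}{(\ell+m)!}}\,P_\ell^m(\cos\theta)e^{jm\varphi},\qquad P_\ell^m(x)=\tfrac{(-1)^m}{2^\ell\ell!}(1-x^2)^{m/2}\tfrac{d^{m+\ell}}{dx^{m+\ell}}(x^2-1)^\ell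 .$$ *Profile.* The Laplace coefficients of the training signal are $$Q_\ell^m=\int_0^{2\pi}\!\!\int_0^\pi q(\varphi,\theta)\,Y_\ell^m(\varphi,\theta)\sin\theta\,d\theta\,d\varphi ,$$ where the integral of a function $f(\varphi,\theta)\sin\theta$ is understood as the limit as $N\to\infty$ of the uniform Riemann sums $\frac{2\pi^2}{N^2}\sum_{i,j=1}^{N} f(\tfrac{2\pi j}{N},\tfrac{\pi i}{N})\sin\tfrac{\pi i}{N}$. For $Y=(r_Y,\varphi_Y,\theta_Y)\in\mathbb{R}^3$ put $$V_\ell^m(Y)=(2\pi)^{3/2}\,j^\ell\,\frac{J_{\ell+\frac12}(2\pi r_Y/\lambda)}{(2\pi r_Y/\lambda)^{1/2}}\,Y_\ell^m(\varphi_Y,\theta_Y),$$ where $J_\nu$ is the Bessel function of the first kind and the quotient is extended by continuity to $r_Y=0$. The channel observation profile is $$\tilde\Phi(Y)=\frac{r_0}{\lambda}\left|\sum_{\ell=0}^\infty\sum_{m=-\ell}^{\ell}\overline{V_\ell^m(Y)}\,Q_\ell^m\right| .$$ *Claim.* For every $U$, $\lambda>0$ and $R$ there is a constant $C$, depending on $U,\lambda,R$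 only, such that for all $r_0>0$, all $\sigma\ge 0$, all user locations with $|X_u|\le R$ and $|X_u|\le r_0/2$ for every $u$, and all noise fields as above, the following holds almost surely: all the limits $Q_\ell^m$ exist, and for every $Y\in\mathbb{R}^3$ the series over $\ell$ in $\tilde\Phi(Y)$ converges absolutely and $$\left|\,\tilde\Phi(Y)-\left|\sum_{u=1}^{U}\mathrm{sinc}\!\left(\tfrac{2\pi}{\lambda}|Y-X_u|\right)\right|\,\right|\le C\,\frac{\max_u|X_u|}{r_0},$$ where $\mathrm{sinc}(x)=\sin x/x$ and $\mathrm{sinc}(0)=1$. That is, $\tilde\Phi(Y)=\left|\sum_u\mathrm{sinc}(\tfrac{2\pi}{\lambda}|Y-X_u|)\right|+O(\max_u|X_u|/r_0)$ almost surely. -/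

import Mathlib

open MeasureTheory ProbabilityTheory Filter Topology

noncomputable section

namespace SphericalArray

/-- Three-dimensional Euclidean space. -/
abbrev E3 : Type := EuclideanSpace ℝ (Fin 3)

/-- The point with spherical coordinates `(r, φ, θ)`: radius, azimuth angle, polar angle. -/
def sphPoint (r φ θ : ℝ) : E3 :=
  !₂[r * (Real.sin θ * Real.cos φ), r * (Real.sin θ * Real.sin φ), r * Real.cos θ]

/-- The azimuth angle of a point, in `(-π, π]`. -/
def azimuth (Y : E3) : ℝ := Complex.arg ⟨Y 0, Y 1⟩

/-- The polar angle of a point, in `[0, π]`. -/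
def polarAngle (Y : E3) : ℝ := Real.arccos (Y 2 / ‖Y‖)

/-- `azimuth` and `polarAngle` are the angles of the spherical coordinates. -/
theorem sphPoint_azimuth_polarAngle (Y : E3) :
    sphPoint ‖Y‖ (azimuth Y) (polarAngle Y) = Y := by
  have hn : ‖Y‖ ^ 2 = Y 0 ^ 2 + Y 1 ^ 2 + Y 2 ^ 2 := by
    simp [EuclideanSpace.norm_sq_eq, Fin.sum_univ_three]
  rcases eq_or_ne Y 0 with rfl | hY
  · ext i; fin_cases i <;> simp [sphPoint]
  have hpos : 0 < ‖Y‖ := norm_pos_iff.mpr hY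
  have habs : ‖(⟨Y 0, Y 1⟩ : ℂ)‖ ^ 2 = Y 0 ^ 2 + Y 1 ^ 2 := by
    rw [Complex.sq_norm, Complex.normSq_mk]; ring
  have hle : |Y 2| ≤ ‖Y‖ := abs_le_of_sq_le_sq
    (by nlinarith [sq_nonneg (Y 0), sq_nonneg (Y 1)]) hpos.le
  have hs : ‖Y‖ * Real.sin (polarAngle Y) = ‖(⟨Y 0, Y 1⟩ : ℂ)‖ := by
    rw [polarAngle, Real.sin_arccos]
    have h1 : 1 - (Y 2 / ‖Y‖) ^ 2 = (‖(⟨Y 0, Y 1⟩ : ℂ)‖ / ‖Y‖) ^ 2 := by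
      field_simp
      rw [habs, hn]; ring
    rw [h1, Real.sqrt_sq (by positivity)]
    field_simp
  have hc : ‖Y‖ * Real.cos (polarAngle Y) = Y 2 := by
    rw [polarAngle, Real.cos_arccos]
    · field_simp
    · rw [le_div_iff₀ hpos]; linarith [(abs_le.mp hle).1]
    · rw [div_le_iff₀ hpos]; linarith [(abs_le.mp hle).2]
  ext i
  fin_cases i
  · simp [sphPoint, ← mul_assoc, hs, azimuth]
  · simp [sphPoint, ← mul_assoc, hs, azimuth]
  · simpa [sphPoint] using hc

/-- The Bessel function of the first kind `J_ν(x)`, of real order `ν`, for `x ≥ 0`. -/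
def besselJ (ν x : ℝ) : ℝ :=
  ∑' k : ℕ, (-1) ^ k / (k.factorial * Real.Gamma (k + ν + 1)) * (x / 2) ^ (2 * (k : ℝ) + ν)

/-- The function `J_{ℓ+1/2}(x) / x^{1/2}` for `x ≥ 0`. Its value at `x = 0` is the limit from the
right, which is `√(2/π)` for `ℓ = 0` and `0` for `ℓ ≥ 1`. -/
def radialFactor (ℓ : ℕ) (x : ℝ) : ℝ :=
  if x = 0 then (if ℓ = 0 then √(2 / Real.pi) else 0)
  else besselJ (ℓ + 1 / 2) x / √x

/-- The associated Legendre function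
`P_ℓ^m(x) = (-1)^m / (2^ℓ ℓ!) (1 - x²)^{m/2} (d/dx)^{m+ℓ} (x² - 1)^ℓ` for `-ℓ ≤ m ≤ ℓ` and
`-1 ≤ x ≤ 1`. -/
def assocLegendre (ℓ : ℕ) (m : ℤ) (x : ℝ) : ℝ :=
  (-1) ^ m / (2 ^ ℓ * ℓ.factorial) * (1 - x ^ 2) ^ ((m : ℝ) / 2) *
    (Polynomial.derivative^[(m + ℓ).toNat]
      ((Polynomial.X ^ 2 - 1) ^ ℓ : Polynomial ℝ)).eval x

/-- The orthonormal spherical harmonic `Y_ℓ^m` at azimuth `φ` and polar angle `θ`, for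
`-ℓ ≤ m ≤ ℓ` and `0 ≤ θ ≤ π`. -/
def sphHarmonic (ℓ : ℕ) (m : ℤ) (φ θ : ℝ) : ℂ :=
  ((√((2 * ℓ + 1) / (4 * Real.pi) *
      (((ℓ - m).toNat.factorial : ℝ) / ((ℓ + m).toNat.factorial : ℝ))) *
    assocLegendre ℓ m (Real.cos θ) : ℝ) : ℂ) * Complex.exp (Complex.I * (m * φ : ℝ))

/-- The law `𝒞𝒩(0, v)`: the real and imaginary parts are independent, each with law
`𝒩(0, v/2)`. -/
def complexGaussian (v : NNReal) : Measure ℂ :=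
  ((gaussianReal 0 (v / 2)).prod (gaussianReal 0 (v / 2))).map
    (fun p : ℝ × ℝ => (⟨p.1, p.2⟩ : ℂ))

/-- The free-space channel response `e^{-i 2π|X - A|/λ} / (√(4π) |X - A|)` between a user at `X`
and an array element at `A`. -/
def channel (wl : ℝ) (X A : E3) : ℂ :=
  ((1 / (√(4 * Real.pi) * dist X A) : ℝ) : ℂ) *
    Complex.exp (-Complex.I * (2 * Real.pi / wl * dist X A : ℝ))

/-- The training signal received at the array element `A` when all the users, located at
`X 0, …, X (U-1)`, transmit the pilot symbol `1`; `noise` is the noise field. -/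
def trainingSignal {U : ℕ} (wl : ℝ) (X : Fin U → E3) (noise : E3 → ℂ) (A : E3) : ℂ :=
  ((wl / √(4 * Real.pi) : ℝ) : ℂ) * ∑ u, channel wl (X u) A + noise A

/-- The `N`-th Riemann sum of `∫_0^{2π} ∫_0^π f(φ, θ) sin θ dθ dφ`, over the uniform grid
`φ = 2πj/N`, `θ = πi/N`, `1 ≤ i, j ≤ N`. -/
def sphRiemannSum (f : ℝ → ℝ → ℂ) (N : ℕ) : ℂ :=
  ∑ j ∈ Finset.Icc 1 N, ∑ i ∈ Finset.Icc 1 N,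
    ((2 * Real.pi / N * (Real.pi / N) : ℝ) : ℂ) *
      (f (2 * Real.pi * j / N) (Real.pi * i / N) * (Real.sin (Real.pi * i / N) : ℂ))

/-- The integral `∫_0^{2π} ∫_0^π f(φ, θ) sin θ dθ dφ`, as the limit of the uniform Riemann sums.
(The sample paths of spatially white noise are not Lebesgue measurable.) -/
def sphIntegral (f : ℝ → ℝ → ℂ) : ℂ := limUnder atTop (sphRiemannSum f)

/-- The integrand `q(φ, θ) Y_ℓ^m(φ, θ)` of the Laplace coefficient, where `q(φ, θ)` is the value
of `q` at the element `(r₀, φ, θ)` of the array of radius `r₀`. -/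
def laplaceIntegrand (r₀ : ℝ) (q : E3 → ℂ) (ℓ : ℕ) (m : ℤ) (φ θ : ℝ) : ℂ :=
  q (sphPoint r₀ φ θ) * sphHarmonic ℓ m φ θ

/-- The Laplace coefficient `Q_ℓ^m` of the signal `q` on the array of radius `r₀`. -/
def laplaceCoeff (r₀ : ℝ) (q : E3 → ℂ) (ℓ : ℕ) (m : ℤ) : ℂ :=
  sphIntegral (laplaceIntegrand r₀ q ℓ m)

/-- `V_ℓ^m(Y) = (2π)^{3/2} i^ℓ J_{ℓ+1/2}(2π|Y|/λ) / (2π|Y|/λ)^{1/2} · Y_ℓ^m(φ_Y, θ_Y)`. -/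
def steering (wl : ℝ) (ℓ : ℕ) (m : ℤ) (Y : E3) : ℂ :=
  (((2 * Real.pi) ^ (3 / 2 : ℝ) * radialFactor ℓ (2 * Real.pi / wl * ‖Y‖) : ℝ) : ℂ) *
    Complex.I ^ ℓ * sphHarmonic ℓ m (azimuth Y) (polarAngle Y)

/-- The degree-`ℓ` part `∑_{m=-ℓ}^{ℓ} conj(V_ℓ^m(Y)) Q_ℓ^m` of the product of `V(Y)` and `Q`. -/
def profileTerm (wl r₀ : ℝ) (q : E3 → ℂ) (Y : E3) (ℓ : ℕ) : ℂ :=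
  ∑ m ∈ Finset.Icc (-(ℓ : ℤ)) ℓ, starRingEnd ℂ (steering wl ℓ m Y) * laplaceCoeff r₀ q ℓ m

/-- The channel observation profile
`(r₀/λ) |∑_{ℓ ≥ 0} ∑_{m=-ℓ}^{ℓ} conj(V_ℓ^m(Y)) Q_ℓ^m|`. -/
def profile (wl r₀ : ℝ) (q : E3 → ℂ) (Y : E3) : ℝ :=
  r₀ / wl * ‖∑' ℓ : ℕ, profileTerm wl r₀ q Y ℓ‖

end SphericalArray

end

/-! Noise. The `N`-th Riemann sum weights about `N²` pairwise independent noise samples by `O(N⁻²)`,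
so its second moment is `O(N⁻²)`, summable in `N`; hence it tends to 0 almost surely
(`ae_tendsto_sphRiemannSum_noise`), for the countably many `(ℓ, m)` at once. On that event `Q_ℓ^m`
is the ordinary integral of the noiseless signal against `Y_ℓ^m`, and the rest is deterministic, for
all `Y` together.

Summation. With `k = 2π/λ`, the addition theorem and Rayleigh's expansion say that `∑ conj
(V_ℓ^m(Y)) Y_ℓ^m(a)` is the plane wave `exp (-i k ⟨Y, a⟩)`. So the profile is `r₀/λ` times the
modulus of the integral over the unit sphere of the noiseless signal against this plane wave. In the
far field, `r₀/λ` times the signal is `exp (-i k r₀) / (4π) * ∑ u, exp (i k ⟨X u, a⟩)` up to `O(max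
|X u| / r₀)`. The common phase disappears in the modulus, and the mean of `exp (-i k ⟨Y - X u, a⟩)`
over the sphere is `sinc (k |Y - X u|)`.

The addition theorem is proved algebraically: `Y_n^m` is a scaled coefficient of the `n`-th power of
a quadratic of discriminant 1 (`harmonicGen`). The sum over `m` is a pairing of two such powers;
factoring one quadratic into linear forms turns it into a central trinomial coefficient, which is a
Legendre polynomial (`coeff_trinomial_pow`). Rayleigh's expansion comes from expanding `t ^ n` in
Legendre polynomials and regrouping a double series. -/

namespace SphericalArray

/-! ### Legendre polynomials as central trinomial coefficients -/

/-- The Legendre polynomials, by the three-term recurrence. -/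
noncomputable def legendreP : ℕ → ℂ → ℂ
  | 0, _ => 1
  | 1, t => t
  | n + 2, t => ((2 * n + 3) * t * legendreP (n + 1) t - (n + 1) * legendreP n t) / (n + 2)

theorem legendreP_succ_mul (n : ℕ) (t : ℂ) :
    (n + 2) * legendreP (n + 2) t =
      (2 * n + 3) * t * legendreP (n + 1) t - (n + 1) * legendreP n t := by
  have : (n + 2 : ℂ) ≠ 0 := by exact_mod_cast (by omega : n + 2 ≠ 0)
  rw [legendreP]; field_simp

/-- A crude bound from the recurrence alone, which needs only `3 (2n+3) + (n+1) ≤ 9 (n+2)`. The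
factorial decay of the Bessel coefficients absorbs `3 ^ n`, so nothing sharper is needed. -/
theorem norm_legendreP_le {t : ℂ} (ht : ‖t‖ ≤ 1) (n : ℕ) : ‖legendreP n t‖ ≤ 3 ^ n := by
  induction n using Nat.twoStepInduction with
  | zero => simp [legendreP]
  | one => simp only [legendreP, pow_one]; linarith
  | more n h0 h1 =>
    have hn : (0 : ℝ) < n + 2 := by positivity
    have h2 : ‖(n + 2 : ℂ)‖ = n + 2 := by
      exact_mod_cast Complex.norm_natCast (n + 2)
    have h3 : ‖(2 * n + 3 : ℂ)‖ = 2 * n + 3 := by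
      exact_mod_cast Complex.norm_natCast (2 * n + 3)
    have h4 : ‖(n + 1 : ℂ)‖ = n + 1 := by
      exact_mod_cast Complex.norm_natCast (n + 1)
    rw [legendreP, norm_div, h2, div_le_iff₀ hn]
    calc _ ≤ ‖(2 * n + 3 : ℂ) * t * legendreP (n + 1) t‖ + ‖(n + 1 : ℂ) * legendreP n t‖ :=
          norm_sub_le _ _
      _ ≤ (2 * n + 3) * 1 * 3 ^ (n + 1) + (n + 1) * 3 ^ n := by
          rw [norm_mul, norm_mul, norm_mul, h3, h4]; gcongr
      _ ≤ 3 ^ (n + 2) * (n + 2) := by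
          have : (0 : ℝ) < 3 ^ n := by positivity
          rw [show (3 : ℝ) ^ (n + 2) = 3 ^ n * 9 by ring, show (3 : ℝ) ^ (n + 1) = 3 ^ n * 3 by ring]
          nlinarith [mul_nonneg (n.cast_nonneg : (0 : ℝ) ≤ n) this.le]

open Polynomial in
-- Let `a n` and `b n` be the coefficients of `X ^ n` in `q ^ n` and `X * q ^ n`. Differentiating `q
-- ^ (n + 1)` yields two linear recurrences between them; eliminating `b` leaves the Legendre
-- recurrence, with `a n` multiplied by the discriminant.
theorem coeff_trinomial_pow {α β γ : ℂ} (h : β ^ 2 - 4 * α * γ = 1) (n : ℕ) :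
    ((C α * X ^ 2 + C β * X + C γ) ^ n).coeff n = legendreP n β := by
  set q : ℂ[X] := C α * X ^ 2 + C β * X + C γ with hq
  have hd : derivative q = C (2 * α) * X + C β := by
    rw [C_mul, map_ofNat C 2]; simp [hq]; ring
  have hD (n : ℕ) : derivative (q ^ (n + 1)) =
      C (n + 1 : ℂ) * (C (2 * α) * (X * q ^ n) + C β * q ^ n) := by
    rw [derivative_pow, hd]; simp; ring
  have e1 (n : ℕ) : (q ^ (n + 1)).coeff (n + 1) =
      2 * α * (X * q ^ n).coeff n + β * (q ^ n).coeff n := by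
    have h1 := congrArg (fun p => coeff p n) (hD n)
    simp only [coeff_derivative, coeff_C_mul, coeff_add] at h1
    have : (n + 1 : ℂ) ≠ 0 := by exact_mod_cast n.succ_ne_zero
    apply mul_right_cancel₀ this
    linear_combination h1
  have e2 (n : ℕ) : (n + 2) * (X * q ^ (n + 1)).coeff (n + 1) =
      (n + 1) * (β * (X * q ^ n).coeff n + 2 * γ * (q ^ n).coeff n) := by
    have h1 : (X * derivative (q ^ (n + 1))).coeff n = n * (q ^ (n + 1)).coeff n := by
      rcases n with _ | n
      · simp
      · rw [coeff_X_mul, coeff_derivative]; push_cast; ring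
    have h2 : X * derivative (q ^ (n + 1)) =
      C (n + 1 : ℂ) * (C (2 * α) * (X ^ 2 * q ^ n) + C β * (X * q ^ n)) := by
      rw [hD]; ring
    rw [h2] at h1
    simp only [coeff_C_mul, coeff_add] at h1
    have h3 : q ^ (n + 1) = C α * (X ^ 2 * q ^ n) + C β * (X * q ^ n) + C γ * q ^ n := by
      rw [pow_succ]; nth_rw 2 [hq]; ring
    have h4 := congrArg (fun p => coeff p n) h3
    simp only [coeff_C_mul, coeff_add] at h4
    rw [coeff_X_mul]
    -- The Euler operator `X d/dX` (`h1`) and `q ^ (n + 1) = q * q ^ n` (`h4`) together eliminate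
    -- the coefficient of `X ^ 2 * q ^ n`.
    linear_combination (2 * (n + 1)) * h4 + h1
  induction n using Nat.twoStepInduction with
  | zero => simp [legendreP]
  | one => simp [legendreP, hq, coeff_C]
  | more n h0 h1 =>
    have hn : (n + 2 : ℂ) ≠ 0 := by exact_mod_cast (by omega : n + 2 ≠ 0)
    apply mul_left_cancel₀ hn
    rw [legendreP_succ_mul, ← h0, ← h1]
    have a := e1 (n + 1)
    have b := e1 n
    have c := e2 n
    rw [show n + 1 + 1 = n + 2 from rfl] at a
    linear_combination (n + 2) * a + 2 * α * c - (n + 1) * β * b - (n + 1) * (q ^ n).coeff n * h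

/-! ### The pairing of coefficients with weights `k! (2n-k)!` -/

open Polynomial in
theorem coeff_linear_pow (a b : ℂ) (n i : ℕ) :
    ((C a * X + C b) ^ n).coeff i = a ^ i * b ^ (n - i) * n.choose i := by
  rw [add_pow, finsetSum_coeff]
  simp only [mul_pow, ← C_pow, mul_assoc, coeff_C_mul, ← C_eq_natCast, ← C_mul, coeff_mul_C,
    coeff_X_pow]
  by_cases hi : i < n + 1
  · rw [Finset.sum_eq_single_of_mem i (by simpa using hi)]
    · simp; 
    · intro j _ hj; simp [hj.symm]
  · rw [Finset.sum_eq_zero, Nat.choose_eq_zero_of_lt (by omega)]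
    · simp
    · intro j hj; simp at hj; simp [show i ≠ j by omega]

open Polynomial in
-- Linear substitutions by a matrix and by its transpose are adjoint for the pairing with weights
-- `k! (2n-k)!`. Concretely, the `i`-th summands agree: both carry `k! (2n-k)! n!² / (i! j! p! r!)`,
-- where `i, j, p, r` are the exponents of `a, c, b, d`.
theorem factorial_mul_coeff_linear_pow_mul (a b c d : ℂ) {n k : ℕ} (hk : k ≤ 2 * n) :
    (k.factorial * (2 * n - k).factorial : ℂ) *
        ((C a * X + C b) ^ n * (C c * X + C d) ^ n).coeff k =
      (n.factorial : ℂ) ^ 2 * ((C a * X + C c) ^ k * (C b * X + C d) ^ (2 * n - k)).coeff n := by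
  rw [coeff_mul, coeff_mul, Finset.Nat.sum_antidiagonal_eq_sum_range_succ_mk,
    Finset.Nat.sum_antidiagonal_eq_sum_range_succ_mk]
  simp only [coeff_linear_pow]
  rw [← Finset.sum_subset (s₁ := Finset.range (min k n + 1)) (s₂ := Finset.range (k + 1)),
    ← Finset.sum_subset (s₁ := Finset.range (min k n + 1)) (s₂ := Finset.range (n + 1)),
    Finset.mul_sum, Finset.mul_sum]
  · refine Finset.sum_congr rfl fun i hi => ?_
    simp at hi
    obtain ⟨j, rfl⟩ : ∃ j, k = i + j := ⟨k - i, by omega⟩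
    obtain ⟨p, rfl⟩ : ∃ p, n = i + p := ⟨n - i, by omega⟩
    by_cases hj : i + p < j
    · rw [Nat.choose_eq_zero_of_lt (n := i + p) (k := i + j - i) (by omega),
        Nat.choose_eq_zero_of_lt (n := 2 * (i + p) - (i + j)) (k := i + p - i) (by omega)]
      simp
    · obtain ⟨r, hr⟩ : ∃ r, i + p = j + r := ⟨i + p - j, by omega⟩
      have e1 : 2 * (i + p) - (i + j) = p + r := by omega
      have e2 : i + p - (i + j - i) = r := by omega
      have e3 : p + r - (i + p - i) = r := by omega
      rw [e1, e2, e3, Nat.add_sub_cancel_left, Nat.add_sub_cancel_left]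
      have c1 : ((i + p).choose i : ℂ) = (i + p).factorial / (i.factorial * p.factorial) :=
        Nat.cast_add_choose ℂ
      have c2 : ((i + p).choose j : ℂ) = (i + p).factorial / (j.factorial * r.factorial) := by
        rw [hr]; exact Nat.cast_add_choose ℂ
      have c3 : ((i + j).choose i : ℂ) = (i + j).factorial / (i.factorial * j.factorial) :=
        Nat.cast_add_choose ℂ
      have c4 : ((p + r).choose p : ℂ) = (p + r).factorial / (p.factorial * r.factorial) :=
        Nat.cast_add_choose ℂ
      rw [c1, c2, c3, c4]
      ring
  · intro x hx; simp at hx ⊢; omega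
  · intro x hx hx'
    simp at hx hx'
    rw [Nat.choose_eq_zero_of_lt (n := k) (k := x) (by omega)]; simp
  · intro x hx; simp at hx ⊢; omega
  · intro x hx hx'
    simp at hx hx'
    rw [Nat.choose_eq_zero_of_lt (n := n) (k := x) (by omega)]; simp

open Polynomial in
-- Evaluate `q ^ n` at `S / T` and clear the denominator `T ^ (2n)`.
theorem sum_map_coeff_trinomial_pow_homogenize {K : Type*} [Field K] (f : ℂ →+* K) (α β γ : ℂ)
    (n : ℕ) (S : K) {T : K} (hT : T ≠ 0) :
    ∑ k ∈ Finset.range (2 * n + 1),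
        f (((C α * X ^ 2 + C β * X + C γ) ^ n).coeff k) * (S ^ k * T ^ (2 * n - k)) =
      (f α * S ^ 2 + f β * (S * T) + f γ * T ^ 2) ^ n := by
  set q : ℂ[X] := C α * X ^ 2 + C β * X + C γ with hq
  have hdeg : (q ^ n).natDegree < 2 * n + 1 := by
    have : q.natDegree ≤ 2 := natDegree_quadratic_le
    have := natDegree_pow_le_of_le n this
    omega
  have h1 := eval₂_eq_sum_range' f hdeg (S / T)
  rw [eval₂_pow] at h1
  have h2 : q.eval₂ f (S / T) * T ^ 2 = f α * S ^ 2 + f β * (S * T) + f γ * T ^ 2 := by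
    simp only [hq, eval₂_add, eval₂_mul, eval₂_C, eval₂_X, eval₂_pow]
    field_simp
  rw [← h2, mul_pow, h1, ← pow_mul, Finset.sum_mul]
  refine Finset.sum_congr rfl fun k hk => ?_
  simp at hk
  have : T ^ (2 * n) = T ^ k * T ^ (2 * n - k) := by rw [← pow_add]; congr 1; omega
  rw [this, div_pow]
  field_simp

open Polynomial in
theorem sum_coeff_trinomial_pow_homogenize (α β γ : ℂ) (n : ℕ) (s : ℂ[X]) {t : ℂ[X]} (ht : t ≠ 0) :
    ∑ k ∈ Finset.range (2 * n + 1),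
        C (((C α * X ^ 2 + C β * X + C γ) ^ n).coeff k) * (s ^ k * t ^ (2 * n - k)) =
      (C α * s ^ 2 + C β * (s * t) + C γ * t ^ 2) ^ n := by
  apply IsFractionRing.injective ℂ[X] (FractionRing ℂ[X])
  have ht' : algebraMap ℂ[X] (FractionRing ℂ[X]) t ≠ 0 := by
    simpa using (IsFractionRing.injective ℂ[X] (FractionRing ℂ[X])).ne ht
  have := sum_map_coeff_trinomial_pow_homogenize ((algebraMap ℂ[X] (FractionRing ℂ[X])).comp C)
    α β γ n (algebraMap ℂ[X] (FractionRing ℂ[X]) s) ht'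
  simpa only [map_sum, map_mul, map_pow, map_add, RingHom.comp_apply] using this

open Polynomial in
-- Adjointness moves the substitution from the product of linear forms to the trinomial. What
-- remains pairs with the middle monomial, whose weight is `n!²`, and so picks out a central
-- coefficient.
theorem sum_factorial_mul_coeff_mul_coeff (a b c d α β γ : ℂ) (n : ℕ) (h : b ≠ 0 ∨ d ≠ 0) :
    ∑ k ∈ Finset.range (2 * n + 1), (k.factorial * (2 * n - k).factorial : ℂ) *
        ((C a * X + C b) ^ n * (C c * X + C d) ^ n).coeff k *
        ((C α * X ^ 2 + C β * X + C γ) ^ n).coeff k =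
      (n.factorial : ℂ) ^ 2 *
        ((C (α * a ^ 2 + β * (a * b) + γ * b ^ 2) * X ^ 2 +
          C (2 * α * (a * c) + β * (a * d + b * c) + 2 * γ * (b * d)) * X +
          C (α * c ^ 2 + β * (c * d) + γ * d ^ 2)) ^ n).coeff n := by
  have ht : (C b * X + C d : ℂ[X]) ≠ 0 := by
    intro h0
    have h1 := congrArg (fun p => coeff p 1) h0
    have h2 := congrArg (fun p => coeff p 0) h0
    simp [coeff_C] at h1 h2
    tauto
  have key := sum_coeff_trinomial_pow_homogenize α β γ n (C a * X + C c) ht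
  have e : C α * (C a * X + C c) ^ 2 + C β * ((C a * X + C c) * (C b * X + C d)) +
      C γ * (C b * X + C d) ^ 2 = (C (α * a ^ 2 + β * (a * b) + γ * b ^ 2) * X ^ 2 +
          C (2 * α * (a * c) + β * (a * d + b * c) + 2 * γ * (b * d)) * X +
          C (α * c ^ 2 + β * (c * d) + γ * d ^ 2) : ℂ[X]) := by
    simp only [map_add, map_mul, map_pow, map_ofNat]; ring
  rw [← e, ← key, finsetSum_coeff, Finset.mul_sum]
  refine Finset.sum_congr rfl fun k hk => ?_
  rw [factorial_mul_coeff_linear_pow_mul _ _ _ _ (by simp at hk; omega), coeff_C_mul]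
  ring

/-! ### Spherical harmonics from a generating quadratic, and the addition theorem -/

open Polynomial in
/-- The quadratic polynomial whose powers generate the spherical harmonics. -/
noncomputable def harmonicGen (φ θ : ℝ) : ℂ[X] :=
  C (-(Real.sin θ / 2) * Complex.exp (Complex.I * φ)) * X ^ 2 + C (Real.cos θ : ℂ) * X +
    C (Real.sin θ / 2 * Complex.exp (-(Complex.I * φ)))

open Polynomial in
theorem taylor_sq_sub_one_pow (x : ℝ) (n : ℕ) :
    taylor x ((X ^ 2 - 1) ^ n : ℝ[X]) = (C (x ^ 2 - 1) + C (2 * x) * X + X ^ 2) ^ n := by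
  rw [taylor_apply]
  simp only [pow_comp, sub_comp, X_comp, one_comp]
  congr 1
  simp only [C_mul, C_sub, C_pow, map_ofNat, map_one]; ring

open Polynomial in
theorem iterate_derivative_sq_sub_one_pow_eval (x : ℝ) (n k : ℕ) :
    (derivative^[k] ((X ^ 2 - 1) ^ n : ℝ[X])).eval x =
      k.factorial * ((C (x ^ 2 - 1) + C (2 * x) * X + X ^ 2) ^ n).coeff k := by
  rw [← taylor_sq_sub_one_pow, taylor_coeff, ← factorial_smul_hasseDeriv]
  simp

open Polynomial in
-- Taylor's formula for `(x + h)² - 1` with `h = s X`: since `x² - 1 = -s²`, a factor `s` comes out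
-- of the quadratic. Keeping the powers of `s` avoids dividing by a possibly zero `s`.
theorem pow_mul_iterate_derivative_sq_sub_one_pow {x s : ℝ} (h : x ^ 2 - 1 = -s ^ 2) (n k : ℕ) :
    s ^ k * (derivative^[k] ((X ^ 2 - 1) ^ n : ℝ[X])).eval x =
      k.factorial * (s ^ n * ((C s * X ^ 2 + C (2 * x) * X - C s) ^ n).coeff k) := by
  have hc (p : ℝ[X]) : s ^ n * (p ^ n).coeff k = ((C s * p) ^ n).coeff k := by
    rw [mul_pow, ← C_pow, coeff_C_mul]
  rw [iterate_derivative_sq_sub_one_pow_eval, hc]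
  have : C s * (C s * X ^ 2 + C (2 * x) * X - C s) =
      (C (x ^ 2 - 1) + C (2 * x) * X + X ^ 2).comp (C s * X) := by
    rw [h]; simp; ring
  rw [this, ← pow_comp, comp_C_mul_X_coeff]
  ring

open Polynomial in
-- `harmonicGen` is the real quadratic of the preceding lemma after `X ↦ -exp (iφ) X`, times `-exp
-- (-iφ) / 2`.
theorem pow_mul_coeff_harmonicGen_pow (φ θ : ℝ) (n k : ℕ) :
    (k.factorial : ℂ) * ((Real.sin θ : ℂ) ^ n * ((harmonicGen φ θ) ^ n).coeff k) =
      (-1) ^ (n + k) * (1 / 2) ^ n * Complex.exp (-(Complex.I * φ)) ^ n *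
        Complex.exp (Complex.I * φ) ^ k * (Real.sin θ : ℂ) ^ k *
        ((derivative^[k] ((X ^ 2 - 1) ^ n : ℝ[X])).eval (Real.cos θ) : ℝ) := by
  set e := Complex.exp (Complex.I * φ) with he
  set e' := Complex.exp (-(Complex.I * φ)) with he'
  have hee : e * e' = 1 := by rw [he, he', ← Complex.exp_add]; simp
  set r : ℝ[X] := C (Real.sin θ) * X ^ 2 + C (2 * Real.cos θ) * X - C (Real.sin θ) with hr
  have h1 : harmonicGen φ θ = C (-e' / 2) * (r.map Complex.ofRealHom).comp (C (-e) * X) := by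
    have h2 : (C e * C e' : ℂ[X]) = 1 := by rw [← C_mul, hee, C_1]
    have h3 : (C (-e' / 2) : ℂ[X]) = - (C e' * C (1 / 2)) := by rw [← C_mul, ← C_neg]; congr 1; ring
    have h4 : (C (Real.sin θ / 2 : ℂ) : ℂ[X]) = C (Real.sin θ : ℂ) * C (1 / 2) := by rw [← C_mul]; congr 1; ring
    have h5 : (C (1 / 2) * 2 : ℂ[X]) = 1 := by
      rw [← map_ofNat C 2, ← C_mul, ← C_1]; congr 1; norm_num
    have h6 : (C ((2 : ℝ) : ℂ) : ℂ[X]) = 2 := by rw [Complex.ofReal_ofNat, map_ofNat]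
    rw [harmonicGen, h3, ← he, ← he', hr]
    simp only [C_mul, C_neg, h4, Polynomial.map_sub, Polynomial.map_add, Polynomial.map_mul,
      Polynomial.map_C, Polynomial.map_pow, Polynomial.map_X, sub_comp, add_comp, mul_comp,
      pow_comp, C_comp, X_comp, Complex.ofRealHom_eq_coe, h6, ofNat_comp]
    linear_combination (X ^ 2 * C e * C (1/2) * C (↑(Real.sin θ)) - C (↑(Real.cos θ)) * X * 2 * C (1/2))
      * h2 - (C (↑(Real.cos θ)) * X) * h5
  rw [h1, mul_pow, ← C_pow, coeff_C_mul, ← pow_comp, comp_C_mul_X_coeff, ← Polynomial.map_pow,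
    coeff_map]
  have h2 := pow_mul_iterate_derivative_sq_sub_one_pow (x := Real.cos θ) (s := Real.sin θ)
    (by have := Real.sin_sq_add_cos_sq θ; linarith) n k
  rw [← hr] at h2
  have h3 := congrArg (fun y : ℝ => (y : ℂ)) h2
  simp only [Complex.ofReal_mul, Complex.ofReal_pow, Complex.ofReal_natCast] at h3
  have h4 : (-e' / 2) ^ n = (-1) ^ n * (1 / 2) ^ n * e' ^ n := by
    rw [← mul_pow, ← mul_pow]; congr 1; ring
  have h5 : (-e) ^ k = (-1) ^ k * e ^ k := by rw [← mul_pow]; congr 1; ring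
  rw [h4, h5, Complex.ofRealHom_eq_coe, pow_add]
  linear_combination (-((-1) ^ n * (1 / 2) ^ n * e' ^ n * ((-1) ^ k * e ^ k))) * h3

open Polynomial in
theorem assocLegendre_mul_exp_eq {θ : ℝ} (h0 : 0 ≤ θ) (hπ : θ ≤ Real.pi) (φ : ℝ) (n k : ℕ) :
    (assocLegendre n ((k : ℤ) - n) (Real.cos θ) : ℂ) *
        Complex.exp (Complex.I * ((((k : ℤ) - n : ℤ) : ℝ) * φ : ℝ)) =
      k.factorial / n.factorial * ((harmonicGen φ θ) ^ n).coeff k := by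
  have hs0 : 0 ≤ Real.sin θ := Real.sin_nonneg_of_nonneg_of_le_pi h0 hπ
  have hn : (n.factorial : ℂ) ≠ 0 := by exact_mod_cast n.factorial_ne_zero
  have hk : (k.factorial : ℂ) ≠ 0 := by exact_mod_cast k.factorial_ne_zero
  have hsq : 1 - Real.cos θ ^ 2 = Real.sin θ ^ 2 := by
    have := Real.sin_sq_add_cos_sq θ; linarith
  have hkn : ((k : ℤ) - n + n).toNat = k := by simp
  unfold assocLegendre
  rw [hkn, hsq]
  rcases hs0.eq_or_lt with hs | hs
  -- At a pole `sin θ` cannot be cancelled, but the quadratic is just `cos θ * X`, so only the order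
  -- `m = 0` survives.
  · have hc : Real.cos θ ^ 2 = 1 := by rw [← hs] at hsq; linarith
    have hg : harmonicGen φ θ = C (Real.cos θ : ℂ) * X := by simp [harmonicGen, ← hs]
    rw [hg, mul_pow, ← C_pow, coeff_C_mul, coeff_X_pow, ← hs]
    by_cases h : k = n
    · subst h
      have : (derivative^[k] ((X ^ 2 - 1) ^ k : ℝ[X])).eval (Real.cos θ) =
          k.factorial * (2 * Real.cos θ) ^ k := by
        rw [iterate_derivative_sq_sub_one_pow_eval, hc]
        have : (C (1 - 1) + C (2 * Real.cos θ) * X + X ^ 2 : ℝ[X]) =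
          X * (C (2 * Real.cos θ) + X) := by simp; ring
        rw [this, mul_pow, coeff_X_pow_mul', if_pos le_rfl, Nat.sub_self,
          coeff_zero_eq_eval_zero]
        simp
      rw [this]
      simp [mul_pow]
      field_simp
    -- The convention `0 ^ y = 0` for every `y ≠ 0` also covers negative orders.
    · have : (0 : ℝ) ^ ((((k : ℤ) - n : ℤ) : ℝ) / 2) = 0 := by
        apply Real.zero_rpow
        have : ((k : ℤ) - n : ℤ) ≠ 0 := by omega
        have : (((k : ℤ) - n : ℤ) : ℝ) ≠ 0 := by exact_mod_cast this
        positivity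
      rw [zero_pow two_ne_zero, this]; simp [h]
  · have hs' : (Real.sin θ : ℂ) ≠ 0 := by exact_mod_cast hs.ne'
    have hr : (Real.sin θ ^ 2) ^ ((((k : ℤ) - n : ℤ) : ℝ) / 2) =
        Real.sin θ ^ k / Real.sin θ ^ n := by
      rw [← Real.rpow_natCast, ← Real.rpow_mul hs.le]
      have : ((2 : ℕ) : ℝ) * ((((k : ℤ) - n : ℤ) : ℝ) / 2) = ((k : ℝ) - n) := by push_cast; ring
      rw [this, Real.rpow_sub hs, Real.rpow_natCast, Real.rpow_natCast]
    have he : Complex.exp (Complex.I * ((((k : ℤ) - n : ℤ) : ℝ) * φ : ℝ)) =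
        Complex.exp (-(Complex.I * φ)) ^ n * Complex.exp (Complex.I * φ) ^ k := by
      rw [← Complex.exp_nat_mul, ← Complex.exp_nat_mul, ← Complex.exp_add]
      congr 1; push_cast; ring
    have hm : ((-1 : ℝ) ^ ((k : ℤ) - n)) = (-1) ^ (n + k) := by
      rw [zpow_sub₀ (by norm_num), zpow_natCast, zpow_natCast, pow_add]
      rcases neg_one_pow_eq_or ℝ n with h | h <;> rw [h] <;> simp [div_neg]
    rw [hr, he, hm]
    have key := pow_mul_coeff_harmonicGen_pow φ θ n k
    apply mul_left_cancel₀ (pow_ne_zero n hs')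
    have hcomm (a b c d : ℂ) : a * (b / c * d) = b * (a * d) / c := by ring
    rw [hcomm (_ ^ n), key]
    simp only [Complex.ofReal_mul, Complex.ofReal_div, Complex.ofReal_pow, Complex.ofReal_neg,
      Complex.ofReal_one, Complex.ofReal_ofNat, Complex.ofReal_natCast, one_div, inv_pow]
    field_simp

/-- The factor between a spherical harmonic and a coefficient of its generating polynomial. -/
noncomputable def harmonicScale (n k : ℕ) : ℝ :=
  √((2 * n + 1) / (4 * Real.pi) * (((2 * n - k).factorial : ℝ) / (k.factorial : ℝ))) *
    (k.factorial / n.factorial)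

theorem sphHarmonic_eq_coeff {θ : ℝ} (h0 : 0 ≤ θ) (hπ : θ ≤ Real.pi) (φ : ℝ) (n k : ℕ) :
    sphHarmonic n ((k : ℤ) - n) φ θ = harmonicScale n k * ((harmonicGen φ θ) ^ n).coeff k := by
  have h := assocLegendre_mul_exp_eq h0 hπ φ n k
  have h1 : ((n : ℤ) - (k - n)).toNat = 2 * n - k := by omega
  have h2 : ((n : ℤ) + (k - n)).toNat = k := by omega
  rw [sphHarmonic, h1, h2, harmonicScale]
  push_cast at h ⊢
  linear_combination
    ((√((2 * n + 1) / (4 * Real.pi) * (((2 * n - k).factorial : ℝ) / (k.factorial : ℝ))) : ℝ) : ℂ) * h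

theorem harmonicScale_sq (n k : ℕ) :
    harmonicScale n k ^ 2 = (2 * n + 1) / (4 * Real.pi) *
      (k.factorial * (2 * n - k).factorial / n.factorial ^ 2) := by
  have hk : (k.factorial : ℝ) ≠ 0 := by exact_mod_cast k.factorial_ne_zero
  rw [harmonicScale, mul_pow, Real.sq_sqrt (by positivity)]
  field_simp

open Polynomial in
theorem conj_coeff_harmonicGen_pow (φ θ : ℝ) (n k : ℕ) :
    starRingEnd ℂ (((harmonicGen φ θ) ^ n).coeff k) = ((harmonicGen (-φ) θ) ^ n).coeff k := by
  rw [← coeff_map, Polynomial.map_pow]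
  congr 2
  simp [harmonicGen, ← Complex.exp_conj, Complex.conj_ofReal]
  simp [← Complex.ofReal_sin, ← Complex.ofReal_cos, Complex.conj_ofReal]
  rw [Complex.conj_ofNat]

theorem sum_Icc_neg_eq_sum_range {M : Type*} [AddCommMonoid M] (n : ℕ) (f : ℤ → M) :
    ∑ m ∈ Finset.Icc (-(n : ℤ)) n, f m = ∑ k ∈ Finset.range (2 * n + 1), f ((k : ℤ) - n) := by
  symm
  refine Finset.sum_bij (fun k _ => (k : ℤ) - n) ?_ ?_ ?_ ?_
  · intro k hk; simp at hk ⊢; omega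
  · intro a _ b _ h; simpa using h
  · intro m hm
    simp at hm
    exact ⟨(m + n).toNat, by simp; omega, by omega⟩
  · intros; rfl

/-- The cosine of the angle between the directions `(φ, θ)` and `(φ', θ')`. -/
noncomputable def cosAngle (φ θ φ' θ' : ℝ) : ℝ :=
  Real.cos θ * Real.cos θ' + Real.sin θ * Real.sin θ' * Real.cos (φ - φ')

open Polynomial in
/-- The addition theorem for spherical harmonics. -/
theorem sum_conj_sphHarmonic_mul_sphHarmonic {θ θ' : ℝ} (h0 : 0 ≤ θ) (hπ : θ ≤ Real.pi)
    (h0' : 0 ≤ θ') (hπ' : θ' ≤ Real.pi) (φ φ' : ℝ) (n : ℕ) :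
    ∑ m ∈ Finset.Icc (-(n : ℤ)) n, starRingEnd ℂ (sphHarmonic n m φ θ) * sphHarmonic n m φ' θ' =
      (2 * n + 1) / (4 * Real.pi) * legendreP n (cosAngle φ θ φ' θ') := by
  set e := Complex.exp (Complex.I * φ) with he
  set e' := Complex.exp (-(Complex.I * φ)) with he'
  have hee : e * e' = 1 := by rw [he, he', ← Complex.exp_add]; simp
  set f := Complex.exp (Complex.I * φ') with hf
  set f' := Complex.exp (-(Complex.I * φ')) with hf'
  have hff : f * f' = 1 := by rw [hf, hf', ← Complex.exp_add]; simp
  set c : ℂ := (Real.cos (θ / 2) : ℂ) with hc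
  set s : ℂ := (Real.sin (θ / 2) : ℂ) with hs
  have hcs : s ^ 2 + c ^ 2 = 1 := by
    rw [hs, hc]
    exact_mod_cast Real.sin_sq_add_cos_sq (θ / 2)
  have hcos : (Real.cos θ : ℂ) = c ^ 2 - s ^ 2 := by
    rw [hc, hs]
    norm_cast
    rw [← Real.cos_two_mul']; congr 1; ring
  have hsin : (Real.sin θ : ℂ) = 2 * s * c := by
    rw [hc, hs]
    norm_cast
    rw [← Real.sin_two_mul]; congr 1; ring
  have hcs' : (Real.sin θ' : ℂ) ^ 2 + (Real.cos θ' : ℂ) ^ 2 = 1 := by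
    exact_mod_cast Real.sin_sq_add_cos_sq θ'
  -- Half-angle formulas split the conjugate quadratic into two linear forms, whose coefficient
  -- matrix has determinant `c² + s² = 1`.
  have hgen : harmonicGen (-φ) θ = (C c * X + C (s * e)) * (C (-(s * e')) * X + C c) := by
    have h2 : (C e * C e' : ℂ[X]) = 1 := by rw [← C_mul, hee, C_1]
    have h3 : (Real.sin θ / 2 : ℂ) = s * c := by rw [hsin]; ring
    have h4 : Complex.exp (Complex.I * (-φ : ℝ)) = e' := by rw [he']; push_cast; ring_nf
    have h5 : Complex.exp (-(Complex.I * (-φ : ℝ))) = e := by rw [he]; push_cast; ring_nf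
    rw [harmonicGen, h3, hcos, h4, h5]
    simp only [C_mul, C_neg, C_sub, C_pow]
    linear_combination (C s ^ 2 * X) * h2
  have hbd : s * e ≠ 0 ∨ c ≠ 0 := by
    by_contra! h
    have he0 : e ≠ 0 := Complex.exp_ne_zero _
    have : s = 0 := by simpa [he0] using h.1
    rw [this, h.2] at hcs; simp at hcs
  have key := sum_factorial_mul_coeff_mul_coeff c (s * e) (-(s * e')) c
    (-(Real.sin θ' / 2) * f) (Real.cos θ') (Real.sin θ' / 2 * f') n hbd
  rw [← mul_pow, ← hgen] at key
  have hβ : 2 * (-(Real.sin θ' / 2) * f) * (c * -(s * e')) +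
      Real.cos θ' * (c * c + s * e * -(s * e')) + 2 * (Real.sin θ' / 2 * f') * (s * e * c) =
      (cosAngle φ θ φ' θ' : ℂ) := by
    have h1 : (Real.cos (φ - φ') : ℂ) = (e * f' + e' * f) / 2 := by
      rw [Complex.ofReal_cos, Complex.cos, he, hf, he', hf', ← Complex.exp_add, ← Complex.exp_add]
      congr 2 <;> congr 1 <;> push_cast <;> ring
    rw [cosAngle]
    push_cast only [Complex.ofReal_add, Complex.ofReal_mul]
    rw [h1, hcos, hsin]
    linear_combination (-(s ^ 2 * (Real.cos θ' : ℂ))) * hee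
  rw [coeff_trinomial_pow, hβ] at key
  · rw [sum_Icc_neg_eq_sum_range]
    have hn : (n.factorial : ℂ) ≠ 0 := by exact_mod_cast n.factorial_ne_zero
    have hterm (k : ℕ) : starRingEnd ℂ (sphHarmonic n ((k : ℤ) - n) φ θ) *
        sphHarmonic n ((k : ℤ) - n) φ' θ' =
        (2 * n + 1) / (4 * Real.pi) / n.factorial ^ 2 * ((k.factorial * (2 * n - k).factorial : ℂ) *
          ((harmonicGen (-φ) θ) ^ n).coeff k * ((harmonicGen φ' θ') ^ n).coeff k) := by
      rw [sphHarmonic_eq_coeff h0 hπ, sphHarmonic_eq_coeff h0' hπ', map_mul, Complex.conj_ofReal,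
        conj_coeff_harmonicGen_pow]
      have := congrArg (fun y : ℝ => (y : ℂ)) (harmonicScale_sq n k)
      push_cast at this
      linear_combination (((harmonicGen (-φ) θ) ^ n).coeff k *
        ((harmonicGen φ' θ') ^ n).coeff k) * this
    simp only [hterm]
    rw [← Finset.mul_sum]
    simp only [harmonicGen] at key ⊢
    rw [key]
    field_simp
  -- The substitution multiplies the discriminant by the squared determinant, so it is still 1, as
  -- `coeff_trinomial_pow` requires.
  · have hdet : c * c - (s * e) * (-(s * e')) = 1 := by
      linear_combination hcs + s ^ 2 * hee
    have hd2 : (Real.cos θ' : ℂ) ^ 2 - 4 * (-(Real.sin θ' / 2) * f) * (Real.sin θ' / 2 * f') = 1 := by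
      linear_combination hcs' + (Real.sin θ' : ℂ) ^ 2 * hff
    generalize s * e = b at *
    generalize -(s * e') = d at *
    generalize -((Real.sin θ' : ℂ) / 2) * f = A at *
    generalize (Real.sin θ' : ℂ) / 2 * f' = G at *
    generalize (Real.cos θ' : ℂ) = B at *
    linear_combination (c * c - b * d) ^ 2 * hd2 + (c * c - b * d + 1) * hdet

/-! ### Rayleigh's plane-wave expansion -/

open scoped Nat in
/-- The coefficient of `x ^ (ℓ + 2 * k)` in the modified spherical Bessel function of order `ℓ`. -/
noncomputable def sphBesselCoeff (ℓ k : ℕ) : ℝ := 1 / (k ! * 2 ^ k * (2 * (k + ℓ) + 1 : ℕ)‼)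

/-- The coefficient of `x ^ n` in the modified spherical Bessel function of order `ℓ`. -/
noncomputable def sphBesselCoeff' (ℓ n : ℕ) : ℝ :=
  if n < ℓ then 0 else if Even (n - ℓ) then sphBesselCoeff ℓ ((n - ℓ) / 2) else 0

theorem sphBesselCoeff'_of_lt {ℓ n : ℕ} (h : n < ℓ) : sphBesselCoeff' ℓ n = 0 := by
  simp [sphBesselCoeff', h]

theorem sphBesselCoeff'_add (ℓ k : ℕ) : sphBesselCoeff' ℓ (ℓ + 2 * k) = sphBesselCoeff ℓ k := by
  simp [sphBesselCoeff']

theorem sphBesselCoeff'_add_add_one (ℓ k : ℕ) : sphBesselCoeff' ℓ (ℓ + 2 * k + 1) = 0 := by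
  have : ℓ + 2 * k + 1 - ℓ = 2 * k + 1 := by omega
  simp [sphBesselCoeff', this]

theorem sphBesselCoeff_eq_mul (ℓ k : ℕ) :
    sphBesselCoeff ℓ k = (2 * k + 2 * ℓ + 3) * sphBesselCoeff (ℓ + 1) k := by
  have h : (2 * (k + (ℓ + 1)) + 1 : ℕ) = 2 * (k + ℓ) + 1 + 2 := by ring
  rw [sphBesselCoeff, sphBesselCoeff, h, Nat.doubleFactorial_add_two]
  have : ((2 * (k + ℓ) + 1).doubleFactorial : ℝ) ≠ 0 := by
    exact_mod_cast (Nat.doubleFactorial_pos _).ne'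
  push_cast
  field_simp
  ring

theorem sphBesselCoeff_succ_eq_mul (ℓ k : ℕ) :
    sphBesselCoeff (ℓ + 1) k = (2 * k + 2) * sphBesselCoeff ℓ (k + 1) := by
  have h : (2 * (k + 1 + ℓ) + 1 : ℕ) = 2 * (k + (ℓ + 1)) + 1 := by ring
  rw [sphBesselCoeff, sphBesselCoeff, h, Nat.factorial_succ]
  have : ((2 * (k + (ℓ + 1)) + 1).doubleFactorial : ℝ) ≠ 0 := by
    exact_mod_cast (Nat.doubleFactorial_pos _).ne'
  push_cast
  field_simp
  ring

/-- Coefficient form of the derivative rule `(2ℓ+3) i_{ℓ+1}' = (ℓ+1) i_ℓ + (ℓ+2) i_{ℓ+2}` for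
modified spherical Bessel functions. -/
theorem sphBesselCoeff'_succ_succ (ℓ n : ℕ) :
    (n + 1) * ((2 * ℓ + 3) * sphBesselCoeff' (ℓ + 1) (n + 1)) =
      (ℓ + 1) * sphBesselCoeff' ℓ n + (ℓ + 2) * sphBesselCoeff' (ℓ + 2) n := by
  rcases lt_or_ge n ℓ with h | h
  · simp [sphBesselCoeff'_of_lt h, sphBesselCoeff'_of_lt (show n + 1 < ℓ + 1 by omega),
      sphBesselCoeff'_of_lt (show n < ℓ + 2 by omega)]
  obtain ⟨j, rfl⟩ := Nat.exists_eq_add_of_le h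
  obtain ⟨k, rfl | rfl⟩ := j.even_or_odd'
  · rcases k with _ | k
    · rw [sphBesselCoeff'_of_lt (show ℓ + 2 * 0 < ℓ + 2 by omega), sphBesselCoeff'_add,
        show ℓ + 2 * 0 + 1 = ℓ + 1 + 2 * 0 by ring, sphBesselCoeff'_add, sphBesselCoeff_eq_mul ℓ]
      push_cast; ring
    · rw [sphBesselCoeff'_add, show ℓ + 2 * (k + 1) + 1 = ℓ + 1 + 2 * (k + 1) by ring,
        sphBesselCoeff'_add, show ℓ + 2 * (k + 1) = ℓ + 2 + 2 * k by ring,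
        sphBesselCoeff'_add, sphBesselCoeff_eq_mul ℓ, sphBesselCoeff_succ_eq_mul (ℓ + 1) k]
      push_cast; ring
  · rw [← add_assoc, sphBesselCoeff'_add_add_one,
      show ℓ + 2 * k + 1 + 1 = ℓ + 1 + 2 * k + 1 by ring, sphBesselCoeff'_add_add_one]
    rcases k with _ | k
    · rw [sphBesselCoeff'_of_lt (by omega)]; simp
    · rw [show ℓ + 2 * (k + 1) + 1 = ℓ + 2 + 2 * k + 1 by ring, sphBesselCoeff'_add_add_one]; simp

/-- Coefficient form of `i_0' = i_1`, the case of the derivative rule without a lower neighbour. -/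
theorem sphBesselCoeff'_zero_succ (n : ℕ) :
    (n + 1) * sphBesselCoeff' 0 (n + 1) = sphBesselCoeff' 1 n := by
  obtain ⟨k, rfl | rfl⟩ := n.even_or_odd'
  · have h := sphBesselCoeff'_add_add_one 0 k
    rw [zero_add] at h
    rw [h]
    rcases k with _ | k
    · rw [sphBesselCoeff'_of_lt (by omega)]; simp
    · rw [show 2 * (k + 1) = 1 + 2 * k + 1 by ring, sphBesselCoeff'_add_add_one]; simp
  · have h := sphBesselCoeff'_add 0 (k + 1)
    rw [zero_add] at h
    rw [show 2 * k + 1 + 1 = 2 * (k + 1) by ring, h, add_comm (2 * k) 1, sphBesselCoeff'_add,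
      sphBesselCoeff_succ_eq_mul]
    push_cast; ring

/-- Induction on `n`: multiplication by `t` acts on Legendre polynomials by their recurrence, and
the derivative rules for the Bessel coefficients match it term by term. -/
theorem pow_eq_sum_legendreP (t : ℂ) (n : ℕ) :
    t ^ n = n.factorial * ∑ ℓ ∈ Finset.range (n + 1),
      ((2 * ℓ + 1) * sphBesselCoeff' ℓ n : ℂ) * legendreP ℓ t := by
  induction n with
  | zero => simp [sphBesselCoeff', sphBesselCoeff, legendreP]
  | succ n ih =>
    have hsum : (n + 1 : ℂ) * ∑ ℓ ∈ Finset.range (n + 1 + 1),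
        ((2 * ℓ + 1) * sphBesselCoeff' ℓ (n + 1) : ℂ) * legendreP ℓ t =
        t * ∑ ℓ ∈ Finset.range (n + 1),
          ((2 * ℓ + 1) * sphBesselCoeff' ℓ n : ℂ) * legendreP ℓ t := by
      have h1 (ℓ : ℕ) : (n + 1 : ℂ) * (((2 * (ℓ + 1 : ℕ) + 1) * sphBesselCoeff' (ℓ + 1) (n + 1) : ℂ)
          * legendreP (ℓ + 1) t) =
          (ℓ + 1) * sphBesselCoeff' ℓ n * legendreP (ℓ + 1) t +
          ((ℓ + 1 : ℕ) + 1) * sphBesselCoeff' (ℓ + 1 + 1) n * legendreP (ℓ + 1) t := by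
        have := congrArg (fun y : ℝ => (y : ℂ)) (sphBesselCoeff'_succ_succ ℓ n)
        push_cast at this ⊢
        linear_combination legendreP (ℓ + 1) t * this
      have h2 (ℓ : ℕ) : t * (((2 * (ℓ + 1 : ℕ) + 1) * sphBesselCoeff' (ℓ + 1) n : ℂ) *
          legendreP (ℓ + 1) t) =
          ((ℓ + 1 : ℕ) + 1) * sphBesselCoeff' (ℓ + 1) n * legendreP (ℓ + 1 + 1) t +
          (ℓ + 1) * sphBesselCoeff' (ℓ + 1) n * legendreP ℓ t := by
        have := legendreP_succ_mul ℓ t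
        push_cast
        linear_combination (-(sphBesselCoeff' (ℓ + 1) n : ℂ)) * this
      rw [Finset.sum_range_succ', mul_add, Finset.mul_sum, Finset.sum_congr rfl fun ℓ _ => h1 ℓ,
        Finset.sum_add_distrib, Finset.sum_range_succ' (fun ℓ : ℕ =>
          ((2 * ℓ + 1) * sphBesselCoeff' ℓ n : ℂ) * legendreP ℓ t) n, mul_add t, Finset.mul_sum,
        Finset.sum_congr rfl fun ℓ _ => h2 ℓ, Finset.sum_add_distrib]
      have h3 := Finset.sum_range_succ'
        (fun ℓ : ℕ => (ℓ + 1 : ℂ) * sphBesselCoeff' (ℓ + 1) n * legendreP ℓ t) (n + 1)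
      rw [Finset.sum_range_succ, Finset.sum_range_succ,
        sphBesselCoeff'_of_lt (show n < n + 1 by omega),
        sphBesselCoeff'_of_lt (show n < n + 1 + 1 by omega)] at h3
      have h4 := Finset.sum_range_succ'
        (fun ℓ : ℕ => (ℓ + 1 : ℂ) * sphBesselCoeff' ℓ n * legendreP (ℓ + 1) t) n
      have h5 := congrArg (fun y : ℝ => (y : ℂ)) (sphBesselCoeff'_zero_succ n)
      simp only [Complex.ofReal_mul, Complex.ofReal_add, Complex.ofReal_natCast,
        Complex.ofReal_one] at h5
      simp only [legendreP, Nat.cast_zero, Complex.ofReal_zero] at h3 h4 ⊢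
      rw [h4]
      linear_combination h5 - h3
    rw [pow_succ', ih, Nat.factorial_succ]
    push_cast at hsum ⊢
    linear_combination (-(n.factorial : ℂ)) * hsum

theorem sphBesselCoeff_nonneg (ℓ k : ℕ) : 0 ≤ sphBesselCoeff ℓ k := by
  unfold sphBesselCoeff; positivity

theorem mul_factorial_le_doubleFactorial (ℓ k : ℕ) :
    (2 * ℓ + 1) * ℓ.factorial ≤ (2 * (k + ℓ) + 1).doubleFactorial := by
  induction k with
  | zero =>
    rw [zero_add]
    induction ℓ with
    | zero => simp
    | succ ℓ ih =>
      rw [show 2 * (ℓ + 1) + 1 = 2 * ℓ + 1 + 2 by ring, Nat.doubleFactorial_add_two,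
        Nat.factorial_succ]
      refine Nat.mul_le_mul_left _ (le_trans (Nat.mul_le_mul_right _ ?_) ih)
      omega
  | succ k ih =>
    rw [show 2 * (k + 1 + ℓ) + 1 = 2 * (k + ℓ) + 1 + 2 by ring, Nat.doubleFactorial_add_two]
    exact ih.trans (Nat.le_mul_of_pos_left _ (by omega))

/-- The double factorial pays for both `2ℓ+1` and `ℓ!`. The bound separates `ℓ` from `k`, so the
double series is dominated by a product of two exponential series. -/
theorem mul_sphBesselCoeff_le (ℓ k : ℕ) :
    (2 * ℓ + 1) * sphBesselCoeff ℓ k ≤ 1 / ℓ.factorial * (1 / k.factorial) := by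
  have h : ((2 * ℓ + 1) * ℓ.factorial : ℝ) ≤ (2 * (k + ℓ) + 1).doubleFactorial := by
    exact_mod_cast mul_factorial_le_doubleFactorial ℓ k
  have hk : (0 : ℝ) < k.factorial := by exact_mod_cast k.factorial_pos
  have hl : (0 : ℝ) < ℓ.factorial := by exact_mod_cast ℓ.factorial_pos
  have hd : (0 : ℝ) < (2 * (k + ℓ) + 1).doubleFactorial := by
    exact_mod_cast Nat.doubleFactorial_pos _
  have h2 : (1 : ℝ) ≤ 2 ^ k := one_le_pow₀ (by norm_num)
  rw [sphBesselCoeff, mul_one_div, one_div_mul_one_div,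
    div_le_div_iff₀ (by positivity) (by positivity)]
  calc (2 * ℓ + 1 : ℝ) * (ℓ.factorial * k.factorial)
      = k.factorial * 1 * ((2 * ℓ + 1) * ℓ.factorial) := by ring
    _ ≤ k.factorial * 2 ^ k * (2 * (k + ℓ) + 1).doubleFactorial := by gcongr
    _ = _ := by ring

/-- The modified spherical Bessel function of the first kind. -/
noncomputable def modSphBessel (ℓ : ℕ) (z : ℂ) : ℂ := ∑' k, (sphBesselCoeff ℓ k : ℂ) * z ^ (ℓ + 2 * k)

theorem norm_planeWave_series_term_le {z t : ℂ} (ht : ‖t‖ ≤ 1) (ℓ k : ℕ) :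
    ‖(2 * ℓ + 1 : ℂ) * (sphBesselCoeff ℓ k * z ^ (ℓ + 2 * k)) * legendreP ℓ t‖ ≤
      (3 * ‖z‖) ^ ℓ / ℓ.factorial * ((‖z‖ ^ 2) ^ k / k.factorial) := by
  have h1 : ‖(2 * ℓ + 1 : ℂ)‖ = 2 * ℓ + 1 := by exact_mod_cast Complex.norm_natCast (2 * ℓ + 1)
  have h2 : ‖(sphBesselCoeff ℓ k : ℂ)‖ = sphBesselCoeff ℓ k := by
    rw [Complex.norm_real, Real.norm_of_nonneg (sphBesselCoeff_nonneg ℓ k)]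
  rw [norm_mul, norm_mul, norm_mul, norm_pow, h1, h2]
  calc (2 * ℓ + 1 : ℝ) * (sphBesselCoeff ℓ k * ‖z‖ ^ (ℓ + 2 * k)) * ‖legendreP ℓ t‖
      = ((2 * ℓ + 1 : ℝ) * sphBesselCoeff ℓ k) * ‖z‖ ^ (ℓ + 2 * k) * ‖legendreP ℓ t‖ := by ring
    _ ≤ (1 / ℓ.factorial * (1 / k.factorial)) * ‖z‖ ^ (ℓ + 2 * k) * 3 ^ ℓ := by
      exact mul_le_mul (mul_le_mul_of_nonneg_right (mul_sphBesselCoeff_le ℓ k) (by positivity))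
        (norm_legendreP_le ht ℓ) (norm_nonneg _) (by positivity)
    _ = _ := by rw [pow_add, pow_mul, mul_pow]; ring

theorem summable_planeWave_series {z t : ℂ} (ht : ‖t‖ ≤ 1) :
    Summable fun p : ℕ × ℕ =>
      (2 * p.1 + 1 : ℂ) * (sphBesselCoeff p.1 p.2 * z ^ (p.1 + 2 * p.2)) * legendreP p.1 t := by
  refine Summable.of_norm_bounded
    ((Real.summable_pow_div_factorial (3 * ‖z‖)).mul_of_nonneg
      (Real.summable_pow_div_factorial (‖z‖ ^ 2)) (fun _ => by positivity)
      (fun _ => by positivity)) fun p => norm_planeWave_series_term_le ht p.1 p.2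

/-- The expansion of a plane wave in Legendre polynomials. -/
theorem hasSum_modSphBessel_mul_legendreP (z : ℂ) {t : ℂ} (ht : ‖t‖ ≤ 1) :
    HasSum (fun ℓ : ℕ => (2 * ℓ + 1 : ℂ) * modSphBessel ℓ z * legendreP ℓ t)
      (Complex.exp (z * t)) := by
  set H : ℕ × ℕ → ℂ := fun p =>
      (2 * p.1 + 1 : ℂ) * (sphBesselCoeff p.1 p.2 * z ^ (p.1 + 2 * p.2)) * legendreP p.1 t with hH
  have hs : Summable H := summable_planeWave_series ht
  set F : ℕ × ℕ → ℂ := fun p =>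
      (2 * p.2 + 1 : ℂ) * (sphBesselCoeff' p.2 p.1 * z ^ p.1) * legendreP p.2 t with hF
  -- From (degree, index) to (power of `z`, degree). `F` vanishes off the range, so the same series
  -- can be summed by powers, giving `exp`, or by degrees.
  let g : ℕ × ℕ → ℕ × ℕ := fun p => (p.1 + 2 * p.2, p.1)
  have hg : Function.Injective g := by
    rintro ⟨a, b⟩ ⟨c, d⟩ h
    simp only [g, Prod.mk.injEq] at h ⊢
    omega
  have hFg : F ∘ g = H := by
    funext p
    simp only [hF, hH, g, Function.comp, sphBesselCoeff'_add]
  have hF0 : ∀ p ∉ Set.range g, F p = 0 := by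
    rintro ⟨n, ℓ⟩ hp
    have : sphBesselCoeff' ℓ n = 0 := by
      unfold sphBesselCoeff'
      split_ifs with h1 h2
      · rfl
      · exfalso
        obtain ⟨r, hr⟩ := h2
        exact hp ⟨(ℓ, r), by simp only [g, Prod.mk.injEq, and_true]; omega⟩
      · rfl
    simp [hF, this]
  have hFs : HasSum F (∑' p, H p) := by
    rw [← hg.hasSum_iff hF0, hFg]; exact hs.hasSum
  have h1 : HasSum (fun n : ℕ => (z * t) ^ n / n.factorial) (∑' p, H p) := by
    refine hFs.prod_fiberwise fun n => ?_
    have : (z * t) ^ n / n.factorial = ∑ ℓ ∈ Finset.range (n + 1), F (n, ℓ) := by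
      have hn : (n.factorial : ℂ) ≠ 0 := by exact_mod_cast n.factorial_ne_zero
      rw [mul_pow, pow_eq_sum_legendreP t n, mul_div_assoc, mul_div_cancel_left₀ _ hn,
        Finset.mul_sum]
      exact Finset.sum_congr rfl fun ℓ _ => by simp only [hF]; ring
    rw [this]
    refine hasSum_sum_of_ne_finset_zero fun ℓ hℓ => ?_
    simp at hℓ
    simp [hF, sphBesselCoeff'_of_lt (show n < ℓ by omega)]
  have h2 : ∑' p, H p = Complex.exp (z * t) := by
    rw [Complex.exp_eq_exp_ℂ]
    exact h1.unique (NormedSpace.expSeries_div_hasSum_exp (z * t))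
  rw [← h2]
  have h3 := hs.hasSum.prod_fiberwise fun ℓ => (hs.prod_factor ℓ).hasSum
  convert h3 using 2 with ℓ
  simp only [hH]
  rw [tsum_mul_right, tsum_mul_left, modSphBessel]

/-- Uniform in `t`; this is the majorant for integrating the expansion term by term. -/
theorem norm_modSphBessel_mul_legendreP_le (z : ℂ) {t : ℂ} (ht : ‖t‖ ≤ 1) (ℓ : ℕ) :
    ‖(2 * ℓ + 1 : ℂ) * modSphBessel ℓ z * legendreP ℓ t‖ ≤
      (3 * ‖z‖) ^ ℓ / ℓ.factorial * Real.exp (‖z‖ ^ 2) := by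
  have h : HasSum (fun k : ℕ => (3 * ‖z‖) ^ ℓ / ℓ.factorial * ((‖z‖ ^ 2) ^ k / k.factorial))
      ((3 * ‖z‖) ^ ℓ / ℓ.factorial * Real.exp (‖z‖ ^ 2)) := by
    rw [Real.exp_eq_exp_ℝ]
    exact (NormedSpace.expSeries_div_hasSum_exp (‖z‖ ^ 2)).mul_left _
  rw [modSphBessel, ← tsum_mul_left, ← tsum_mul_right]
  exact tsum_of_norm_bounded h fun k => norm_planeWave_series_term_le ht ℓ k

theorem summable_modSphBessel_bound (z : ℂ) :
    Summable fun ℓ : ℕ => (3 * ‖z‖) ^ ℓ / ℓ.factorial * Real.exp (‖z‖ ^ 2) :=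
  (Real.summable_pow_div_factorial _).mul_right _

/-- The half-integer values of Gamma produce the double factorials, their `√π` joins `(2π)^(3/2)` to
give `4π`, and the alternating signs are absorbed in the imaginary argument. -/
theorem modSphBessel_mul_eq_radialFactor (ℓ : ℕ) {x : ℝ} (hx : 0 ≤ x) :
    (((2 * Real.pi) ^ (3 / 2 : ℝ) * radialFactor ℓ x : ℝ) : ℂ) * (-Complex.I) ^ ℓ =
      4 * Real.pi * modSphBessel ℓ (-(Complex.I * x)) := by
  have hpi := Real.pi_pos
  have hconst : (2 * Real.pi) ^ (3 / 2 : ℝ) * √(2 / Real.pi) = 4 * Real.pi := by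
    rw [Real.sqrt_eq_rpow, show (3 / 2 : ℝ) = 1 + 1 / 2 by norm_num,
      Real.rpow_add (by positivity), Real.rpow_one, mul_assoc,
      ← Real.mul_rpow (by positivity) (by positivity), show 2 * Real.pi * (2 / Real.pi) = 2 ^ 2 by
        field_simp, ← Real.sqrt_eq_rpow, Real.sqrt_sq (by norm_num)]
    ring
  have hrad : radialFactor ℓ x = √(2 / Real.pi) *
      ∑' k : ℕ, sphBesselCoeff ℓ k * ((-1) ^ k * x ^ (ℓ + 2 * k)) := by
    -- At `x = 0` only `ℓ = k = 0` contributes, in agreement with the limiting value in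
    -- `radialFactor`.
    rcases hx.eq_or_lt with rfl | hx
    · rw [radialFactor, if_pos rfl]
      split_ifs with h
      · subst h
        rw [tsum_eq_single 0]
        · simp [sphBesselCoeff]
        · intro k hk; simp [hk]
      · rw [tsum_eq_single 0] <;> simp [h]
    · rw [radialFactor, if_neg hx.ne', besselJ, ← tsum_div_const, ← tsum_mul_left]
      congr 1
      funext k
      have hG : Real.Gamma (k + (ℓ + 1 / 2) + 1) =
          (2 * (k + ℓ) + 1).doubleFactorial * √Real.pi / 2 ^ (k + ℓ + 1) := by
        have := Real.Gamma_nat_add_half (k + ℓ + 1)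
        rw [show 2 * (k + ℓ + 1) - 1 = 2 * (k + ℓ) + 1 by omega] at this
        rw [← this]; congr 1; push_cast; ring
      have hp : (x / 2) ^ (2 * (k : ℝ) + (ℓ + 1 / 2)) =
          x ^ (ℓ + 2 * k) / 2 ^ (ℓ + 2 * k) * (√x / √2) := by
        rw [show 2 * (k : ℝ) + (ℓ + 1 / 2) = ((ℓ + 2 * k : ℕ) : ℝ) + 1 / 2 by push_cast; ring,
          Real.rpow_add (by positivity), Real.rpow_natCast, ← Real.sqrt_eq_rpow, div_pow,
          Real.sqrt_div hx.le]
      have hsx : √x ≠ 0 := (Real.sqrt_pos.mpr hx).ne'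
      have hsp : √Real.pi ≠ 0 := (Real.sqrt_pos.mpr hpi).ne'
      have hs2 : √(2 : ℝ) ^ 2 = 2 := Real.sq_sqrt (by norm_num)
      have hd : ((2 * (k + ℓ) + 1).doubleFactorial : ℝ) ≠ 0 := by
        exact_mod_cast (Nat.doubleFactorial_pos _).ne'
      rw [hG, hp, sphBesselCoeff, Real.sqrt_div (by norm_num)]
      field_simp
      rw [hs2]
      ring
  rw [hrad, ← mul_assoc, hconst, modSphBessel]
  push_cast
  rw [mul_assoc, ← tsum_mul_right]
  congr 2
  funext k
  rw [neg_mul_eq_neg_mul, mul_pow, pow_add (-Complex.I), pow_mul, neg_sq, Complex.I_sq]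
  ring

theorem conj_steering {wl : ℝ} (hwl : 0 < wl) (ℓ : ℕ) (m : ℤ) (Y : E3) :
    starRingEnd ℂ (steering wl ℓ m Y) =
      4 * Real.pi * modSphBessel ℓ (-(Complex.I * (2 * Real.pi / wl * ‖Y‖ : ℝ))) *
        starRingEnd ℂ (sphHarmonic ℓ m (azimuth Y) (polarAngle Y)) := by
  have hpi := Real.pi_pos
  rw [← modSphBessel_mul_eq_radialFactor ℓ (by positivity), steering, map_mul, map_mul, map_pow,
    Complex.conj_I, Complex.conj_ofReal]

/-! ### Riemann sums and integration over the angles -/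

theorem norm_riemannSum_sub_integral_le {g : ℝ → ℂ} (hg : Continuous g) {b : ℝ} (hb : 0 ≤ b) {N : ℕ}
    (hN : 0 < N) {ε : ℝ}
    (h : ∀ x ∈ Set.Icc 0 b, ∀ y ∈ Set.Icc 0 b, |x - y| ≤ b / N → ‖g x - g y‖ ≤ ε) :
    ‖∑ i ∈ Finset.Icc 1 N, ((b / N : ℝ) : ℂ) * g (b * i / N) - ∫ x in (0 : ℝ)..b, g x‖ ≤ b * ε := by
  have hN' : (0 : ℝ) < N := by exact_mod_cast hN
  set a : ℕ → ℝ := fun i => b * i / N with ha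
  have hint := intervalIntegral.sum_integral_adjacent_intervals (f := g) (a := a) (n := N)
    (μ := volume) fun k _ => hg.intervalIntegrable _ _
  have ha0 : a 0 = 0 := by simp [ha]
  have haN : a N = b := by simp only [ha]; field_simp
  have hstep (i : ℕ) : a (i + 1) - a i = b / N := by simp only [ha]; push_cast; ring
  rw [ha0, haN] at hint
  have hsum : ∑ i ∈ Finset.Icc 1 N, ((b / N : ℝ) : ℂ) * g (b * i / N) =
      ∑ i ∈ Finset.range N, ((b / N : ℝ) : ℂ) * g (a (i + 1)) := by
    rw [Finset.range_eq_Ico, Finset.sum_Ico_add' (fun i => ((b / N : ℝ) : ℂ) * g (a i)) 0 N 1]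
    rfl
  rw [hsum, ← hint, ← Finset.sum_sub_distrib]
  calc _ ≤ ∑ i ∈ Finset.range N, ε * (b / N) := by
        refine norm_sum_le_of_le _ fun i hi => ?_
        have hi' : i + 1 ≤ N := by simpa using hi
        have hle : a i ≤ a (i + 1) := by
          have := hstep i
          have : 0 ≤ b / N := by positivity
          linarith
        have hi0 : 0 ≤ a i := by simp only [ha]; positivity
        have hiN : a (i + 1) ≤ b := by
          rw [← haN]; simp only [ha]; gcongr
        have e : ((b / N : ℝ) : ℂ) * g (a (i + 1)) - ∫ x in a i..a (i + 1), g x =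
            ∫ x in a i..a (i + 1), (g (a (i + 1)) - g x) := by
          rw [intervalIntegral.integral_sub (by simp) (hg.intervalIntegrable _ _),
            intervalIntegral.integral_const, hstep, Complex.real_smul]
        rw [e]
        have := intervalIntegral.norm_integral_le_of_norm_le_const (a := a i) (b := a (i + 1))
          (C := ε) (f := fun x => g (a (i + 1)) - g x) fun x hx => by
            rw [Set.uIoc_of_le hle] at hx
            refine h _ ⟨by linarith, hiN⟩ _ ⟨by linarith [hx.1], hx.2.trans hiN⟩ ?_
            rw [abs_of_nonneg (by linarith [hx.2]), ← hstep i]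
            linarith [hx.1]
        rwa [hstep, abs_of_nonneg (by positivity)] at this
    _ = b * ε := by
        rw [Finset.sum_const, Finset.card_range, nsmul_eq_mul]; field_simp

theorem tendsto_doubleRiemannSum {F : ℝ → ℝ → ℂ} (hF : Continuous (Function.uncurry F))
    {a b : ℝ} (ha : 0 ≤ a) (hb : 0 ≤ b) :
    Tendsto (fun N : ℕ => ∑ j ∈ Finset.Icc 1 N, ∑ i ∈ Finset.Icc 1 N,
      ((a / N * (b / N) : ℝ) : ℂ) * F (a * j / N) (b * i / N)) atTop
      (𝓝 (∫ x in (0 : ℝ)..a, ∫ y in (0 : ℝ)..b, F x y)) := by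
  set I : ℝ → ℂ := fun x => ∫ y in (0 : ℝ)..b, F x y with hI
  have hFx (x : ℝ) : Continuous (F x) := hF.comp (by fun_prop : Continuous fun y => (x, y))
  have hIc : Continuous I := by
    exact intervalIntegral.continuous_parametric_intervalIntegral_of_continuous' hF 0 b
  have hK : IsCompact (Set.Icc 0 a ×ˢ Set.Icc 0 b) := isCompact_Icc.prod isCompact_Icc
  have hu := hK.uniformContinuousOn_of_continuous hF.continuousOn
  rw [Metric.uniformContinuousOn_iff] at hu
  rw [Metric.tendsto_atTop]
  intro ε hε
  -- Inner and outer sums each cost `a * b * η`; the `+ 1` covers zero side lengths and makes the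
  -- final inequality strict.
  set η : ℝ := ε / (2 * a * b + 1) with hη
  have hden : 0 < 2 * a * b + 1 := by positivity
  have hη0 : 0 < η := by positivity
  obtain ⟨δ, hδ, hδ'⟩ := hu η hη0
  obtain ⟨N₀, hN₀⟩ := exists_nat_gt (max a b / δ)
  refine ⟨N₀ + 1, fun N hN => ?_⟩
  have hNpos : 0 < N := by omega
  have hNr : (0 : ℝ) < N := by exact_mod_cast hNpos
  have hlt : max a b / N < δ := by
    rw [div_lt_iff₀ hNr]
    rw [div_lt_iff₀ hδ] at hN₀
    have : (N₀ : ℝ) ≤ N := by exact_mod_cast (by omega : N₀ ≤ N)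
    nlinarith
  have hlta : a / N < δ := lt_of_le_of_lt (by gcongr; exact le_max_left _ _) hlt
  have hltb : b / N < δ := lt_of_le_of_lt (by gcongr; exact le_max_right _ _) hlt
  have hFclose : ∀ x ∈ Set.Icc 0 a, ∀ x' ∈ Set.Icc 0 a, ∀ y ∈ Set.Icc 0 b, ∀ y' ∈ Set.Icc 0 b,
      |x - x'| < δ → |y - y'| < δ → ‖F x y - F x' y'‖ ≤ η := by
    intro x hx x' hx' y hy y' hy' h1 h2
    have := hδ' (x, y) ⟨hx, hy⟩ (x', y') ⟨hx', hy'⟩ (by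
      rw [Prod.dist_eq, Real.dist_eq, Real.dist_eq]; exact max_lt h1 h2)
    rw [dist_eq_norm] at this
    exact this.le
  have h1 : ‖∑ j ∈ Finset.Icc 1 N, ((a / N : ℝ) : ℂ) * I (a * j / N) - ∫ x in (0 : ℝ)..a, I x‖ ≤
      a * (η * b) := by
    refine norm_riemannSum_sub_integral_le hIc ha hNpos fun x hx y hy hxy => ?_
    simp only [hI]
    rw [← intervalIntegral.integral_sub ((hFx x).intervalIntegrable _ _)
      ((hFx y).intervalIntegrable _ _)]
    have := intervalIntegral.norm_integral_le_of_norm_le_const (a := 0) (b := b)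
      (C := η) (f := fun t => F x t - F y t) fun t ht => by
        rw [Set.uIoc_of_le hb] at ht
        have ht' : t ∈ Set.Icc 0 b := ⟨ht.1.le, ht.2⟩
        exact hFclose x hx y hy t ht' t ht' (hxy.trans_lt hlta) (by simpa using hδ)
    rwa [sub_zero, abs_of_nonneg hb] at this
  have h2 : ‖∑ j ∈ Finset.Icc 1 N, ∑ i ∈ Finset.Icc 1 N,
      ((a / N * (b / N) : ℝ) : ℂ) * F (a * j / N) (b * i / N) -
      ∑ j ∈ Finset.Icc 1 N, ((a / N : ℝ) : ℂ) * I (a * j / N)‖ ≤ a * (b * η) := by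
    rw [← Finset.sum_sub_distrib]
    calc _ ≤ ∑ j ∈ Finset.Icc 1 N, a / N * (b * η) := by
          refine norm_sum_le_of_le _ fun j hj => ?_
          simp only [Finset.mem_Icc] at hj
          have hjN : (j : ℝ) ≤ N := by exact_mod_cast hj.2
          have hx : a * j / N ∈ Set.Icc 0 a :=
            ⟨by positivity, by rw [div_le_iff₀ hNr]; gcongr⟩
          have e : ∑ i ∈ Finset.Icc 1 N, ((a / N * (b / N) : ℝ) : ℂ) * F (a * j / N) (b * i / N) -
              ((a / N : ℝ) : ℂ) * I (a * j / N) = ((a / N : ℝ) : ℂ) *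
              (∑ i ∈ Finset.Icc 1 N, ((b / N : ℝ) : ℂ) * F (a * j / N) (b * i / N) -
                ∫ y in (0 : ℝ)..b, F (a * j / N) y) := by
            rw [mul_sub, Finset.mul_sum]
            congr 1
            refine Finset.sum_congr rfl fun i _ => ?_
            push_cast; ring
          rw [e, norm_mul, Complex.norm_real, Real.norm_of_nonneg (by positivity)]
          gcongr
          refine norm_riemannSum_sub_integral_le (hFx _) hb hNpos fun x hx' y hy hxy => ?_
          exact hFclose _ hx _ hx x hx' y hy (by simpa using hδ) (hxy.trans_lt hltb)
      _ = a * (b * η) := by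
          rw [Finset.sum_const, Nat.card_Icc, nsmul_eq_mul, Nat.add_sub_cancel]; field_simp
  rw [dist_eq_norm]
  calc _ ≤ a * (b * η) + a * (η * b) := (norm_sub_le_norm_sub_add_norm_sub _ _ _).trans (add_le_add h2 h1)
    _ = (2 * a * b) * η := by ring
    _ < (2 * a * b + 1) * η := by linarith
    _ = ε := by rw [hη]; field_simp

/-- The range `(0, 2π] × (0, π]` of the spherical angles, with Lebesgue measure. -/
noncomputable def angleMeasure : Measure (ℝ × ℝ) :=
  (volume.restrict (Set.Ioc 0 (2 * Real.pi))).prod (volume.restrict (Set.Ioc 0 Real.pi))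

instance : IsFiniteMeasure angleMeasure := by unfold angleMeasure; infer_instance

theorem angleMeasure_eq : angleMeasure =
    (volume : Measure (ℝ × ℝ)).restrict (Set.Ioc 0 (2 * Real.pi) ×ˢ Set.Ioc 0 Real.pi) := by
  rw [angleMeasure, Measure.prod_restrict]; rfl

theorem ae_angleMeasure : ∀ᵐ p ∂angleMeasure, 0 ≤ p.2 ∧ p.2 ≤ Real.pi := by
  rw [angleMeasure_eq]
  filter_upwards [ae_restrict_mem (measurableSet_Ioc.prod measurableSet_Ioc)] with p hp
  exact ⟨hp.2.1.le, hp.2.2⟩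

theorem integrable_angleMeasure {F : ℝ × ℝ → ℂ} (hF : Continuous F) : Integrable F angleMeasure := by
  rw [angleMeasure_eq]
  exact (hF.continuousOn.integrableOn_compact (isCompact_Icc.prod isCompact_Icc)).mono_set
    (Set.prod_mono Set.Ioc_subset_Icc_self Set.Ioc_subset_Icc_self)

/-- The flat area of the rectangle of angles, not the area of the sphere: `sin θ` always stays in
the integrand. -/
theorem measureReal_angleMeasure : angleMeasure.real Set.univ = 2 * Real.pi ^ 2 := by
  have := Real.pi_pos
  rw [angleMeasure, ← Set.univ_prod_univ, measureReal_prod_prod]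
  simp [Real.volume_real_Ioc, this.le]
  ring

theorem integral_angleMeasure {F : ℝ × ℝ → ℂ} (hF : Continuous F) :
    ∫ p, F p ∂angleMeasure =
      ∫ x in (0 : ℝ)..(2 * Real.pi), ∫ y in (0 : ℝ)..Real.pi, F (x, y) := by
  have := Real.pi_pos
  have hi := integrable_angleMeasure hF
  rw [angleMeasure] at hi ⊢
  rw [integral_prod _ hi, intervalIntegral.integral_of_le (by positivity)]
  simp only [intervalIntegral.integral_of_le this.le]

/-- Agreement with a continuous `G` is asked only for `0 ≤ θ ≤ π`, the range where the formula for
the spherical harmonics is meaningful. -/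
theorem tendsto_sphRiemannSum {f : ℝ → ℝ → ℂ} {G : ℝ × ℝ → ℂ} (hG : Continuous G)
    (h : ∀ φ θ, 0 ≤ θ → θ ≤ Real.pi → f φ θ = G (φ, θ)) :
    Tendsto (sphRiemannSum f) atTop (𝓝 (∫ p, G p * (Real.sin p.2 : ℂ) ∂angleMeasure)) := by
  have hpi := Real.pi_pos
  rw [integral_angleMeasure (by fun_prop)]
  have := tendsto_doubleRiemannSum (F := fun x y => G (x, y) * (Real.sin y : ℂ))
    (a := 2 * Real.pi) (b := Real.pi) (by simp only [Function.uncurry_def]; fun_prop)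
    (by positivity) hpi.le
  refine this.congr fun N => ?_
  unfold sphRiemannSum
  refine Finset.sum_congr rfl fun j _ => Finset.sum_congr rfl fun i hi => ?_
  simp only [Finset.mem_Icc] at hi
  have hNr : (0 : ℝ) < N := by exact_mod_cast (by omega : 0 < N)
  have hiN : (i : ℝ) ≤ N := by exact_mod_cast hi.2
  rw [h _ _ (by positivity) (by rw [div_le_iff₀ hNr]; gcongr)]

open Polynomial in
theorem continuous_coeff_harmonicGen_pow (n k : ℕ) :
    Continuous fun p : ℝ × ℝ => ((harmonicGen p.1 p.2) ^ n).coeff k := by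
  induction n generalizing k with
  | zero => simpa using continuous_const
  | succ n ih =>
    simp only [pow_succ, coeff_mul]
    refine continuous_finsetSum _ fun x _ => (ih _).mul ?_
    simp only [harmonicGen, coeff_add, coeff_C_mul, coeff_X_pow, coeff_X, coeff_C]
    split_ifs <;> fun_prop

/-- The spherical harmonics extend continuously to all angles. -/
theorem exists_continuous_eq_sphHarmonic {n : ℕ} {m : ℤ} (h1 : -(n : ℤ) ≤ m) :
    ∃ G : ℝ × ℝ → ℂ, Continuous G ∧
      ∀ φ θ, 0 ≤ θ → θ ≤ Real.pi → sphHarmonic n m φ θ = G (φ, θ) := by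
  obtain ⟨k, rfl⟩ : ∃ k : ℕ, m = k - n := ⟨(m + n).toNat, by omega⟩
  exact ⟨fun p => harmonicScale n k * ((harmonicGen p.1 p.2) ^ n).coeff k,
    continuous_const.mul (continuous_coeff_harmonicGen_pow n k),
    fun φ θ h0 hπ => sphHarmonic_eq_coeff h0 hπ φ n k⟩

/-! ### Almost sure vanishing of the noise sums -/

theorem memLp_id_complexGaussian (v : NNReal) : MemLp (fun z : ℂ => z) 2 (complexGaussian v) := by
  have h : MemLp (fun x : ℝ => x) 2 (gaussianReal 0 (v / 2)) := memLp_id_gaussianReal 2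
  have hm : Measurable fun p : ℝ × ℝ => (⟨p.1, p.2⟩ : ℂ) :=
    Complex.measurableEquivRealProd.symm.measurable
  rw [complexGaussian, memLp_map_measure_iff (by fun_prop) hm.aemeasurable]
  have h1 : MemLp (fun x : ℝ => (x : ℂ)) 2 (gaussianReal 0 (v / 2)) := h.ofReal
  have h2 := (h1.comp_fst (gaussianReal 0 (v / 2))).add
    ((h1.comp_snd (gaussianReal 0 (v / 2))).mul_const Complex.I)
  refine h2.ae_eq (ae_of_all _ fun p => ?_)
  simp [Complex.ext_iff]

theorem integral_id_complexGaussian (v : NNReal) : ∫ z, z ∂(complexGaussian v) = 0 := by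
  have h : MemLp (fun x : ℝ => x) 1 (gaussianReal 0 (v / 2)) := memLp_id_gaussianReal 1
  have h1 : Integrable (fun x : ℝ => (x : ℂ)) (gaussianReal 0 (v / 2)) :=
    (memLp_one_iff_integrable.mp h).ofReal
  have hm : Measurable fun p : ℝ × ℝ => (⟨p.1, p.2⟩ : ℂ) :=
    Complex.measurableEquivRealProd.symm.measurable
  rw [complexGaussian, integral_map hm.aemeasurable (by fun_prop)]
  have e (p : ℝ × ℝ) : (⟨p.1, p.2⟩ : ℂ) = (p.1 : ℂ) + (p.2 : ℂ) * Complex.I := by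
    simp [Complex.ext_iff]
  simp only [e]
  rw [integral_add (h1.comp_fst _) ((h1.comp_snd _).mul_const _), integral_mul_const,
    integral_fun_fst (fun x : ℝ => (x : ℂ)), integral_fun_snd (fun x : ℝ => (x : ℂ)),
    integral_complex_ofReal]
  simp

/-- The expectation of `∑ N, S N ^ 2` is finite, so this series converges almost surely and its
terms tend to 0. -/
theorem ae_tendsto_zero_of_integral_sq_le {Ω : Type*} [MeasurableSpace Ω] {μ : Measure Ω} {S : ℕ → Ω → ℝ} (hS : ∀ N, MemLp (S N) 2 μ) {b : ℕ → ℝ}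
    (hb : ∀ N, ∫ ω, S N ω ^ 2 ∂μ ≤ b N) (hsum : Summable b) :
    ∀ᵐ ω ∂μ, Tendsto (fun N => S N ω) atTop (𝓝 0) := by
  have hm (N : ℕ) : AEMeasurable (fun ω => ENNReal.ofReal (S N ω ^ 2)) μ :=
    ((hS N).aestronglyMeasurable.aemeasurable.pow_const 2).ennreal_ofReal
  have hfin : ∫⁻ ω, ∑' N, ENNReal.ofReal (S N ω ^ 2) ∂μ ≠ ⊤ := by
    rw [lintegral_tsum hm]
    refine ne_top_of_le_ne_top hsum.tsum_ofReal_ne_top (ENNReal.tsum_le_tsum fun N => ?_)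
    rw [← ofReal_integral_eq_lintegral_ofReal (hS N).integrable_sq
      (ae_of_all _ fun _ => sq_nonneg _)]
    exact ENNReal.ofReal_le_ofReal (hb N)
  filter_upwards [ae_lt_top' (AEMeasurable.tsum hm) hfin] with ω hω
  have h1 := ENNReal.tendsto_atTop_zero_of_tsum_ne_top hω.ne
  have h2 := (ENNReal.tendsto_toReal ENNReal.zero_ne_top).comp h1
  have h3 : Tendsto (fun N => √(S N ω ^ 2)) atTop (𝓝 (√0)) := by
    refine (Real.continuous_sqrt.tendsto 0).comp (h2.congr fun N => ?_)
    simp [ENNReal.toReal_ofReal (sq_nonneg _)]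
  rw [Real.sqrt_zero] at h3
  refine (tendsto_zero_iff_abs_tendsto_zero _).mpr (h3.congr fun N => ?_)
  rw [Real.sqrt_sq_eq_abs]; rfl

/-- The summands are centred and variances add under pairwise independence. Composing with `L`,
later the real or imaginary part, reduces to real variances. -/
theorem integral_sq_sum_le {Ω : Type*} [MeasurableSpace Ω] {μ : Measure Ω}
    [IsProbabilityMeasure μ] {κ : Type*} {s : Finset κ} {v : NNReal} {w : κ → ℂ} {Z : κ → Ω → ℂ}
    (hlaw : ∀ p ∈ s, HasLaw (Z p) (complexGaussian v) μ)
    (hind : (s : Set κ).Pairwise fun p q => IndepFun (Z p) (Z q) μ)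
    {L : ℂ →L[ℝ] ℝ} (hL : ∀ z, |L z| ≤ ‖z‖) :
    MemLp (fun ω => L (∑ p ∈ s, w p * Z p ω)) 2 μ ∧
    ∫ ω, L (∑ p ∈ s, w p * Z p ω) ^ 2 ∂μ ≤
      (∑ p ∈ s, ‖w p‖ ^ 2) * ∫ z, ‖z‖ ^ 2 ∂(complexGaussian v) := by
  set X : κ → Ω → ℝ := fun p ω => L (w p * Z p ω) with hX
  have hZ (p) (hp : p ∈ s) : MemLp (Z p) 2 μ := by
    have h := memLp_id_complexGaussian v
    rw [← (hlaw p hp).map_eq] at h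
    exact (memLp_map_measure_iff (by fun_prop) (hlaw p hp).aemeasurable).mp h
  have hXm (p) (hp : p ∈ s) : MemLp (X p) 2 μ :=
    L.comp_memLp' ((hZ p hp).const_mul (w p))
  have hXi : (s : Set κ).Pairwise fun p q => IndepFun (X p) (X q) μ := fun p hp q hq hpq =>
    (hind hp hq hpq).comp (φ := fun z => L (w p * z)) (ψ := fun z => L (w q * z))
      (by fun_prop) (by fun_prop)
  have hX0 (p) (hp : p ∈ s) : ∫ ω, X p ω ∂μ = 0 := by
    have hi : Integrable (fun ω => w p * Z p ω) μ :=
      ((hZ p hp).const_mul (w p)).integrable (by norm_num)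
    simp only [hX]
    rw [L.integral_comp_comm hi, integral_const_mul, (hlaw p hp).integral_eq,
      integral_id_complexGaussian]
    simp
  have hsum : (fun ω => L (∑ p ∈ s, w p * Z p ω)) = ∑ p ∈ s, X p := by
    funext ω; simp [hX]
  have hSm : MemLp (∑ p ∈ s, X p) 2 μ := memLp_finsetSum' s hXm
  have hS0 : ∫ ω, (∑ p ∈ s, X p) ω ∂μ = 0 := by
    simp only [Finset.sum_apply]
    rw [integral_finsetSum s fun p hp => (hXm p hp).integrable (by norm_num)]
    exact Finset.sum_eq_zero hX0
  refine ⟨hsum ▸ hSm, ?_⟩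
  have e : ∫ ω, L (∑ p ∈ s, w p * Z p ω) ^ 2 ∂μ = ∫ ω, (∑ p ∈ s, X p) ω ^ 2 ∂μ := by
    rw [← hsum]
  rw [e, ← variance_of_integral_eq_zero hSm.aestronglyMeasurable.aemeasurable hS0,
    IndepFun.variance_sum hXm hXi, Finset.sum_mul]
  refine Finset.sum_le_sum fun p hp => ?_
  have hn : ∫ ω, ‖Z p ω‖ ^ 2 ∂μ = ∫ z, ‖z‖ ^ 2 ∂(complexGaussian v) := by
    have := (hlaw p hp).integral_comp (f := fun z => ‖z‖ ^ 2) (by fun_prop)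
    exact this
  have hzi : Integrable (fun ω => ‖Z p ω‖ ^ 2) μ := (hZ p hp).integrable_norm_pow (by norm_num)
  refine (variance_le_expectation_sq (hXm p hp).aestronglyMeasurable).trans ?_
  rw [← hn, ← integral_const_mul]
  refine integral_mono (hXm p hp).integrable_sq (hzi.const_mul _) fun ω => ?_
  simp only [Pi.pow_apply, hX]
  rw [← mul_pow, ← norm_mul, ← sq_abs]
  exact pow_le_pow_left₀ (abs_nonneg _) (hL _) 2

theorem ae_tendsto_weighted_sum_zero {Ω : Type*} [MeasurableSpace Ω] {μ : Measure Ω}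
    [IsProbabilityMeasure μ] {κ : Type*} {s : ℕ → Finset κ} {v : NNReal} {w : ℕ → κ → ℂ}
    {Z : ℕ → κ → Ω → ℂ}
    (hlaw : ∀ N, ∀ p ∈ s N, HasLaw (Z N p) (complexGaussian v) μ)
    (hind : ∀ N, (s N : Set κ).Pairwise fun p q => IndepFun (Z N p) (Z N q) μ)
    (hsum : Summable fun N => ∑ p ∈ s N, ‖w N p‖ ^ 2) :
    ∀ᵐ ω ∂μ, Tendsto (fun N => ∑ p ∈ s N, w N p * Z N p ω) atTop (𝓝 0) := by
  have key (L : ℂ →L[ℝ] ℝ) (hL : ∀ z, |L z| ≤ ‖z‖) :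
      ∀ᵐ ω ∂μ, Tendsto (fun N => L (∑ p ∈ s N, w N p * Z N p ω)) atTop (𝓝 0) :=
    ae_tendsto_zero_of_integral_sq_le
      (fun N => (integral_sq_sum_le (hlaw N) (hind N) hL).1)
      (fun N => (integral_sq_sum_le (hlaw N) (hind N) hL).2) (hsum.mul_right _)
  filter_upwards [key Complex.reCLM Complex.abs_re_le_norm, key Complex.imCLM Complex.abs_im_le_norm]
    with ω h1 h2
  have h3 := ((Complex.continuous_ofReal.tendsto 0).comp h1).add
    (((Complex.continuous_ofReal.tendsto 0).comp h2).mul_const Complex.I)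
  simp only [Complex.ofReal_zero, zero_mul, add_zero] at h3
  refine h3.congr fun N => ?_
  exact Complex.re_add_im _

theorem norm_sphPoint (r φ θ : ℝ) : ‖sphPoint r φ θ‖ = |r| := by
  rw [← Real.sqrt_sq_eq_abs, EuclideanSpace.norm_eq]
  congr 1
  simp [sphPoint, Fin.sum_univ_three]
  linear_combination r ^ 2 * Real.sin θ ^ 2 * Real.sin_sq_add_cos_sq φ +
    r ^ 2 * Real.sin_sq_add_cos_sq θ

/-- Injectivity of `cos` on `[0, π]` gives `θ`; off the poles `sin θ` cancels, so `cos (φ - φ') = 1`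
with `|φ - φ'| < 2π`. -/
theorem sphPoint_injOn {r : ℝ} (hr : 0 < r) {φ θ φ' θ' : ℝ} (h0 : 0 < φ) (h1 : φ ≤ 2 * Real.pi)
    (h2 : 0 < θ) (h3 : θ < Real.pi) (h0' : 0 < φ') (h1' : φ' ≤ 2 * Real.pi) (h2' : 0 < θ')
    (h3' : θ' < Real.pi) (h : sphPoint r φ θ = sphPoint r φ' θ') : φ = φ' ∧ θ = θ' := by
  have e0 := congrArg (fun p : E3 => p 0) h
  have e1 := congrArg (fun p : E3 => p 1) h
  have e2 := congrArg (fun p : E3 => p 2) h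
  simp [sphPoint, hr.ne'] at e0 e1 e2
  have hθ : θ = θ' := Real.injOn_cos ⟨h2.le, h3.le⟩ ⟨h2'.le, h3'.le⟩ e2
  subst hθ
  have hs : Real.sin θ ≠ 0 := (Real.sin_pos_of_pos_of_lt_pi h2 h3).ne'
  simp [hs] at e0 e1
  refine ⟨?_, rfl⟩
  have hc : Real.cos (φ - φ') = 1 := by
    rw [Real.cos_sub, e0, e1]
    linear_combination Real.sin_sq_add_cos_sq φ'
  have := (Real.cos_eq_one_iff_of_lt_of_lt (by linarith) (by linarith)).mp hc
  linarith

theorem ae_tendsto_sphRiemannSum_noise {Ω : Type*} [MeasurableSpace Ω] {μ : Measure Ω}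
    [IsProbabilityMeasure μ] {r₀ : ℝ} (hr : 0 < r₀) {v : NNReal} {z : E3 → Ω → ℂ}
    (hlaw : ∀ A ∈ Metric.sphere (0 : E3) r₀, HasLaw (z A) (complexGaussian v) μ)
    (hind : ∀ A ∈ Metric.sphere (0 : E3) r₀, ∀ B ∈ Metric.sphere (0 : E3) r₀,
      A ≠ B → IndepFun (z A) (z B) μ)
    {n : ℕ} {m : ℤ} (hm : -(n : ℤ) ≤ m) :
    ∀ᵐ ω ∂μ, Tendsto (sphRiemannSum (laplaceIntegrand r₀ (fun A => z A ω) n m)) atTop (𝓝 0) := by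
  have hpi := Real.pi_pos
  obtain ⟨G, hGc, hG⟩ := exists_continuous_eq_sphHarmonic hm
  obtain ⟨B, hB⟩ := (isCompact_Icc.prod isCompact_Icc :
    IsCompact (Set.Icc (0 : ℝ) (2 * Real.pi) ×ˢ Set.Icc (0 : ℝ) Real.pi)).exists_bound_of_continuousOn
      hGc.continuousOn
  have hsphere (φ θ : ℝ) : sphPoint r₀ φ θ ∈ Metric.sphere (0 : E3) r₀ := by
    simp [norm_sphPoint, abs_of_pos hr]
  -- The row `i = N` is left out: its nodes all lie at the south pole and share one noise value, but
  -- `sin π = 0` gives them no weight. The remaining nodes are distinct points.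
  let s : ℕ → Finset (ℕ × ℕ) := fun N => Finset.Icc 1 N ×ˢ Finset.Ico 1 N
  let w : ℕ → ℕ × ℕ → ℂ := fun N p => ((2 * Real.pi / N * (Real.pi / N) : ℝ) : ℂ) *
    (sphHarmonic n m (2 * Real.pi * p.1 / N) (Real.pi * p.2 / N) * (Real.sin (Real.pi * p.2 / N) : ℂ))
  let Z : ℕ → ℕ × ℕ → Ω → ℂ := fun N p => z (sphPoint r₀ (2 * Real.pi * p.1 / N) (Real.pi * p.2 / N))
  have hrange {N : ℕ} {p : ℕ × ℕ} (hp : p ∈ s N) : (0 : ℝ) < N ∧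
      0 < 2 * Real.pi * p.1 / N ∧ 2 * Real.pi * p.1 / N ≤ 2 * Real.pi ∧
      0 < Real.pi * p.2 / N ∧ Real.pi * p.2 / N < Real.pi := by
    simp only [s, Finset.mem_product, Finset.mem_Icc, Finset.mem_Ico] at hp
    have hN : (0 : ℝ) < N := by exact_mod_cast (by omega : 0 < N)
    have a1 : (0 : ℝ) < p.1 := by exact_mod_cast hp.1.1
    have a2 : (p.1 : ℝ) ≤ N := by exact_mod_cast hp.1.2
    have a3 : (0 : ℝ) < p.2 := by exact_mod_cast hp.2.1
    have a4 : (p.2 : ℝ) < N := by exact_mod_cast hp.2.2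
    refine ⟨hN, by positivity, ?_, by positivity, ?_⟩
    · rw [div_le_iff₀ hN]; gcongr
    · rw [div_lt_iff₀ hN]; gcongr
  have hw {N : ℕ} {p : ℕ × ℕ} (hp : p ∈ s N) : ‖w N p‖ ^ 2 ≤ (2 * Real.pi ^ 2 * B) ^ 2 / N ^ 4 := by
    obtain ⟨hN, h0, h1, h2, h3⟩ := hrange hp
    have hb := hB (2 * Real.pi * p.1 / N, Real.pi * p.2 / N) ⟨⟨h0.le, h1⟩, ⟨h2.le, h3.le⟩⟩
    rw [← hG _ _ h2.le h3.le] at hb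
    have hB0 : 0 ≤ B := (norm_nonneg _).trans hb
    have : ‖w N p‖ ≤ 2 * Real.pi ^ 2 * B / N ^ 2 := by
      simp only [w]
      rw [norm_mul, norm_mul, Complex.norm_real, Complex.norm_real,
        Real.norm_of_nonneg (by positivity)]
      calc _ ≤ 2 * Real.pi / N * (Real.pi / N) * (B * 1) := by
            gcongr; exact Real.abs_sin_le_one _
        _ = _ := by field_simp
    calc ‖w N p‖ ^ 2 ≤ (2 * Real.pi ^ 2 * B / N ^ 2) ^ 2 := by gcongr
      _ = _ := by rw [div_pow]; ring
  -- At most `N²` terms of size `O(N⁻⁴)`.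
  have hsum : Summable fun N => ∑ p ∈ s N, ‖w N p‖ ^ 2 := by
    have h2 : Summable fun N : ℕ => (2 * Real.pi ^ 2 * B) ^ 2 * (1 / (N : ℝ) ^ 2) :=
      (Real.summable_one_div_nat_pow.mpr one_lt_two).mul_left _
    refine h2.of_nonneg_of_le (fun N => by positivity) fun N => ?_
    calc _ ≤ ∑ p ∈ s N, (2 * Real.pi ^ 2 * B) ^ 2 / (N : ℝ) ^ 4 := Finset.sum_le_sum fun p hp => hw hp
      _ = (N * (N - 1 : ℕ) : ℕ) * ((2 * Real.pi ^ 2 * B) ^ 2 / (N : ℝ) ^ 4) := by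
          simp [s, Finset.sum_const, Finset.card_product]
      _ ≤ (N * N : ℕ) * ((2 * Real.pi ^ 2 * B) ^ 2 / (N : ℝ) ^ 4) := by
          gcongr; omega
      _ ≤ _ := by
          rcases N.eq_zero_or_pos with rfl | hN
          · simp
          · push_cast; field_simp; rfl
  have key := ae_tendsto_weighted_sum_zero (μ := μ) (s := s) (w := w) (Z := Z) (v := v)
    (fun N p _ => hlaw _ (hsphere _ _))
    (fun N p hp q hq hpq => hind _ (hsphere _ _) _ (hsphere _ _) fun h => hpq (by
      obtain ⟨hN, h0, h1, h2, h3⟩ := hrange hp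
      obtain ⟨_, h0', h1', h2', h3'⟩ := hrange hq
      have := sphPoint_injOn hr h0 h1 h2 h3 h0' h1' h2' h3' h
      obtain ⟨e1, e2⟩ := this
      field_simp at e1 e2
      exact Prod.ext (by exact_mod_cast e1) (by exact_mod_cast e2))) hsum
  filter_upwards [key] with ω hω
  refine hω.congr fun N => ?_
  simp only [s, w, Z, sphRiemannSum, Finset.sum_product, laplaceIntegrand]
  refine Finset.sum_congr rfl fun j _ => ?_
  rcases N.eq_zero_or_pos with rfl | hN
  · simp
  · have hN' : (N : ℝ) ≠ 0 := by positivity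
    rw [← Finset.Ico_insert_right hN, Finset.sum_insert (by simp)]
    have : Real.pi * N / N = Real.pi := by field_simp
    rw [this, Real.sin_pi]
    simp only [Complex.ofReal_zero, mul_zero, zero_add]
    exact Finset.sum_congr rfl fun i _ => by ring

/-! ### Summing the profile series to a plane-wave integral -/

theorem continuous_sphPoint (r : ℝ) : Continuous fun p : ℝ × ℝ => sphPoint r p.1 p.2 := by
  unfold sphPoint
  refine (PiLp.continuous_toLp 2 _).comp (continuous_pi fun i => ?_)
  fin_cases i <;> simp <;> fun_prop

theorem inner_sphPoint (r r' φ θ φ' θ' : ℝ) :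
    inner ℝ (sphPoint r φ θ) (sphPoint r' φ' θ') = r * r' * cosAngle φ θ φ' θ' := by
  simp [sphPoint, cosAngle, PiLp.inner_apply, Fin.sum_univ_three, Real.cos_sub]
  ring

theorem abs_cosAngle_le_one (φ θ φ' θ' : ℝ) : |cosAngle φ θ φ' θ'| ≤ 1 := by
  have h := abs_real_inner_le_norm (sphPoint 1 φ θ) (sphPoint 1 φ' θ')
  simpa [inner_sphPoint, norm_sphPoint] using h

theorem continuous_legendreP (n : ℕ) : Continuous (legendreP n) := by
  induction n using Nat.twoStepInduction with
  | zero => exact continuous_const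
  | one => exact continuous_id
  | more n h0 h1 =>
    have e : legendreP (n + 2) = fun t =>
        ((2 * n + 3) * t * legendreP (n + 1) t - (n + 1) * legendreP n t) / (n + 2) := by
      funext t; rw [legendreP]
    rw [e]
    fun_prop

/-- The plane wave `exp (-i k Y ⬝ a)` as a function of the angles of the unit vector `a`. -/
noncomputable def planeWave (k : ℝ) (Y : E3) (p : ℝ × ℝ) : ℂ :=
  Complex.exp (-(Complex.I * (k * inner ℝ Y (sphPoint 1 p.1 p.2) : ℝ)))

theorem continuous_planeWave (k : ℝ) (Y : E3) : Continuous (planeWave k Y) := by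
  have := continuous_sphPoint 1
  unfold planeWave
  fun_prop

theorem norm_planeWave (k : ℝ) (Y : E3) (p : ℝ × ℝ) : ‖planeWave k Y p‖ = 1 := by
  rw [planeWave, Complex.norm_exp]; simp

theorem planeWave_sub (k : ℝ) (Y X : E3) (p : ℝ × ℝ) :
    planeWave k (Y - X) p =
      Complex.exp (Complex.I * (k * inner ℝ X (sphPoint 1 p.1 p.2) : ℝ)) * planeWave k Y p := by
  rw [planeWave, planeWave, ← Complex.exp_add, inner_sub_left]
  congr 1; push_cast; ring

theorem planeWave_eq (k : ℝ) (Y : E3) (p : ℝ × ℝ) : planeWave k Y p =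
    Complex.exp (-(Complex.I * (k * ‖Y‖ : ℝ)) *
      (cosAngle (azimuth Y) (polarAngle Y) p.1 p.2 : ℝ)) := by
  have h := inner_sphPoint ‖Y‖ 1 (azimuth Y) (polarAngle Y) p.1 p.2
  rw [sphPoint_azimuth_polarAngle] at h
  rw [planeWave, h]
  congr 1; push_cast; ring

/-- The degree-`ℓ` part of the plane wave. -/
noncomputable def planeWaveTerm (k : ℝ) (Y : E3) (ℓ : ℕ) (p : ℝ × ℝ) : ℂ :=
  (2 * ℓ + 1) * modSphBessel ℓ (-(Complex.I * (k * ‖Y‖ : ℝ))) *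
    legendreP ℓ (cosAngle (azimuth Y) (polarAngle Y) p.1 p.2 : ℝ)

theorem continuous_planeWaveTerm (k : ℝ) (Y : E3) (ℓ : ℕ) : Continuous (planeWaveTerm k Y ℓ) := by
  unfold planeWaveTerm cosAngle
  refine continuous_const.mul ((continuous_legendreP ℓ).comp ?_)
  fun_prop

theorem norm_cosAngle_le_one (φ θ φ' θ' : ℝ) : ‖(cosAngle φ θ φ' θ' : ℂ)‖ ≤ 1 := by
  rw [Complex.norm_real]; exact abs_cosAngle_le_one _ _ _ _

theorem hasSum_planeWaveTerm (k : ℝ) (Y : E3) (p : ℝ × ℝ) :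
    HasSum (fun ℓ => planeWaveTerm k Y ℓ p) (planeWave k Y p) := by
  rw [planeWave_eq]
  exact hasSum_modSphBessel_mul_legendreP _ (norm_cosAngle_le_one _ _ _ _)

/-- The addition theorem; the `4π` in the steering factor cancels its `1 / (4π)`. -/
theorem sum_conj_steering_mul_sphHarmonic {wl : ℝ} (hwl : 0 < wl) (Y : E3) (ℓ : ℕ) {p : ℝ × ℝ}
    (h0 : 0 ≤ p.2) (hπ : p.2 ≤ Real.pi) :
    ∑ m ∈ Finset.Icc (-(ℓ : ℤ)) ℓ, starRingEnd ℂ (steering wl ℓ m Y) * sphHarmonic ℓ m p.1 p.2 =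
      planeWaveTerm (2 * Real.pi / wl) Y ℓ p := by
  have hpi : (Real.pi : ℂ) ≠ 0 := by exact_mod_cast Real.pi_ne_zero
  have h := sum_conj_sphHarmonic_mul_sphHarmonic (θ := polarAngle Y) (Real.arccos_nonneg _)
    (Real.arccos_le_pi _) h0 hπ (azimuth Y) p.1 ℓ
  simp only [conj_steering hwl, mul_assoc _ (starRingEnd ℂ _) (sphHarmonic _ _ _ _)]
  rw [← Finset.mul_sum, h, planeWaveTerm]
  field_simp

theorem integrable_mul_sphHarmonic_mul_sin {Q : ℝ × ℝ → ℂ} (hQ : Continuous Q) {ℓ : ℕ} {m : ℤ}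
    (hm : -(ℓ : ℤ) ≤ m) :
    Integrable (fun p => Q p * sphHarmonic ℓ m p.1 p.2 * (Real.sin p.2 : ℂ)) angleMeasure := by
  obtain ⟨G, hGc, hG⟩ := exists_continuous_eq_sphHarmonic hm
  refine (integrable_angleMeasure (F := fun p => Q p * G p * (Real.sin p.2 : ℂ))
    (by fun_prop)).congr ?_
  filter_upwards [ae_angleMeasure] with p hp
  rw [hG _ _ hp.1 hp.2]

theorem sum_conj_steering_mul_integral {wl : ℝ} (hwl : 0 < wl) {Q : ℝ × ℝ → ℂ} (hQ : Continuous Q)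
    (Y : E3) (ℓ : ℕ) :
    ∑ m ∈ Finset.Icc (-(ℓ : ℤ)) ℓ, starRingEnd ℂ (steering wl ℓ m Y) *
      ∫ p, Q p * sphHarmonic ℓ m p.1 p.2 * (Real.sin p.2 : ℂ) ∂angleMeasure =
    ∫ p, Q p * planeWaveTerm (2 * Real.pi / wl) Y ℓ p * (Real.sin p.2 : ℂ) ∂angleMeasure := by
  simp only [← integral_const_mul]
  rw [← integral_finsetSum _ fun m hm => (integrable_mul_sphHarmonic_mul_sin hQ
    (Finset.mem_Icc.mp hm).1).const_mul _]
  refine integral_congr_ae ?_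
  filter_upwards [ae_angleMeasure] with p hp
  rw [← sum_conj_steering_mul_sphHarmonic hwl Y ℓ hp.1 hp.2, Finset.mul_sum, Finset.sum_mul]
  exact Finset.sum_congr rfl fun m _ => by ring

/-- Dominated convergence, with the uniform majorant of the plane-wave expansion. This sums the
profile series. -/
theorem hasSum_integral_planeWaveTerm (k : ℝ) {Q : ℝ × ℝ → ℂ} (hQ : Continuous Q) (Y : E3) :
    HasSum (fun ℓ => ∫ p, Q p * planeWaveTerm k Y ℓ p * (Real.sin p.2 : ℂ) ∂angleMeasure)
      (∫ p, Q p * planeWave k Y p * (Real.sin p.2 : ℂ) ∂angleMeasure) := by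
  set z : ℂ := -(Complex.I * (k * ‖Y‖ : ℝ)) with hz
  refine hasSum_integral_of_dominated_convergence
    (fun ℓ p => ‖Q p‖ * ((3 * ‖z‖) ^ ℓ / ℓ.factorial * Real.exp (‖z‖ ^ 2))) (fun ℓ => ?_)
    (fun ℓ => ae_of_all _ fun p => ?_) (ae_of_all _ fun p => (summable_modSphBessel_bound z).mul_left _)
    ?_ (ae_of_all _ fun p => ((hasSum_planeWaveTerm k Y p).mul_left (Q p)).mul_right _)
  · have := continuous_planeWaveTerm k Y ℓ
    exact (by fun_prop : Continuous fun p : ℝ × ℝ =>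
      Q p * planeWaveTerm k Y ℓ p * (Real.sin p.2 : ℂ)).aestronglyMeasurable
  · rw [norm_mul, norm_mul, Complex.norm_real]
    have h1 : ‖planeWaveTerm k Y ℓ p‖ ≤ _ :=
      norm_modSphBessel_mul_legendreP_le z (norm_cosAngle_le_one _ _ _ _) ℓ
    have h2 := Real.abs_sin_le_one p.2
    calc _ ≤ ‖Q p‖ * ‖planeWaveTerm k Y ℓ p‖ * 1 := by gcongr; exact h2
      _ ≤ _ := by rw [mul_one]; gcongr
  · simp only [tsum_mul_left]
    exact (integrable_angleMeasure hQ).norm.mul_const _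

/-! ### The spherical mean of a plane wave -/

theorem integral_exp_int_mul {m : ℤ} (hm : m ≠ 0) :
    ∫ x in (0 : ℝ)..(2 * Real.pi), Complex.exp (Complex.I * (m * x : ℝ)) = 0 := by
  have hm' : Complex.I * m ≠ 0 := mul_ne_zero Complex.I_ne_zero (by exact_mod_cast hm)
  have e (x : ℝ) : Complex.I * (m * x : ℝ) = Complex.I * m * x := by push_cast; ring
  simp only [e]
  rw [integral_exp_mul_complex hm']
  have : Complex.I * m * (2 * Real.pi : ℝ) = m * (2 * Real.pi * Complex.I) := by push_cast; ring
  rw [this, Complex.exp_int_mul_two_pi_mul_I]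
  simp

open Polynomial in
theorem iterate_derivative_sq_sub_one_pow_eval_eq_zero {n k : ℕ} (h : k < n) {x : ℝ}
    (hx : x ^ 2 = 1) : (derivative^[k] ((X ^ 2 - 1) ^ n : ℝ[X])).eval x = 0 := by
  obtain ⟨r, hr⟩ := pow_sub_dvd_iterate_derivative_pow (X ^ 2 - 1 : ℝ[X]) n k
  rw [hr, eval_mul, eval_pow]
  simp [hx, Nat.sub_ne_zero_of_lt h]

open Polynomial in
-- By Rodrigues' formula the integrand is the derivative of a polynomial in `cos θ` that still has
-- the factor `x² - 1`, so both boundary values vanish.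
theorem integral_assocLegendre_zero {n : ℕ} (hn : n ≠ 0) :
    ∫ x in (0 : ℝ)..Real.pi, assocLegendre n 0 (Real.cos x) * Real.sin x = 0 := by
  obtain ⟨n, rfl⟩ := Nat.exists_eq_succ_of_ne_zero hn
  set P : ℝ[X] := derivative^[n] ((X ^ 2 - 1) ^ (n + 1) : ℝ[X]) with hP
  have hd (x : ℝ) : HasDerivAt (fun x => -P.eval (Real.cos x))
      ((derivative P).eval (Real.cos x) * Real.sin x) x := by
    have := ((P.hasDerivAt (Real.cos x)).comp x (Real.hasDerivAt_cos x)).neg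
    exact this.congr_deriv (by rw [mul_neg, neg_neg])
  have hi := intervalIntegral.integral_eq_sub_of_hasDerivAt (a := 0) (b := Real.pi)
    (fun x _ => hd x) (by
      apply Continuous.intervalIntegrable
      have := (derivative P).continuous
      fun_prop)
  rw [Real.cos_pi, Real.cos_zero,
    iterate_derivative_sq_sub_one_pow_eval_eq_zero n.lt_succ_self (by norm_num),
    iterate_derivative_sq_sub_one_pow_eval_eq_zero n.lt_succ_self (by norm_num)] at hi
  have e (x : ℝ) : assocLegendre (n + 1) 0 (Real.cos x) * Real.sin x =
      1 / (2 ^ (n + 1) * (n + 1).factorial) * ((derivative P).eval (Real.cos x) * Real.sin x) := by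
    have : ((0 : ℤ) + (n + 1 : ℕ)).toNat = n + 1 := by omega
    rw [assocLegendre, this, Function.iterate_succ_apply', ← hP]
    simp
    ring
  simp only [Nat.succ_eq_add_one, e]
  rw [intervalIntegral.integral_const_mul, hi]
  simp

theorem integral_sphHarmonic_mul_sin {ℓ : ℕ} (hℓ : ℓ ≠ 0) (m : ℤ) :
    ∫ p, sphHarmonic ℓ m p.1 p.2 * (Real.sin p.2 : ℂ) ∂angleMeasure = 0 := by
  have hpi := Real.pi_pos
  set c : ℝ := √((2 * ℓ + 1) / (4 * Real.pi) *
      (((ℓ - m).toNat.factorial : ℝ) / ((ℓ + m).toNat.factorial : ℝ))) with hc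
  have e (p : ℝ × ℝ) : sphHarmonic ℓ m p.1 p.2 * (Real.sin p.2 : ℂ) =
      Complex.exp (Complex.I * (m * p.1 : ℝ)) *
        ((c * (assocLegendre ℓ m (Real.cos p.2) * Real.sin p.2) : ℝ) : ℂ) := by
    rw [sphHarmonic, ← hc]
    push_cast
    ring
  simp only [e]
  rw [angleMeasure, integral_prod_mul (fun x : ℝ => Complex.exp (Complex.I * (m * x : ℝ)))
    (fun y : ℝ => ((c * (assocLegendre ℓ m (Real.cos y) * Real.sin y) : ℝ) : ℂ)),
    ← intervalIntegral.integral_of_le (by positivity), ← intervalIntegral.integral_of_le hpi.le]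
  by_cases hm : m = 0
  · subst hm
    rw [intervalIntegral.integral_ofReal, intervalIntegral.integral_const_mul,
      integral_assocLegendre_zero hℓ]
    simp
  · rw [integral_exp_int_mul hm, zero_mul]

theorem integral_sin_angleMeasure : ∫ p, (Real.sin p.2 : ℂ) ∂angleMeasure = 4 * Real.pi := by
  rw [integral_angleMeasure (by fun_prop)]
  simp only [intervalIntegral.integral_ofReal, integral_sin, intervalIntegral.integral_const]
  simp
  ring

theorem modSphBessel_zero (x : ℝ) : modSphBessel 0 (-(Complex.I * x)) = Real.sinc x := by
  have hc (k : ℕ) : (sphBesselCoeff 0 k : ℂ) = 1 / (2 * k + 1).factorial := by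
    rw [Nat.factorial_eq_mul_doubleFactorial, Nat.doubleFactorial_two_mul, sphBesselCoeff]
    push_cast
    rw [add_zero]; ring
  have ht (k : ℕ) : (sphBesselCoeff 0 k : ℂ) * (-(Complex.I * x)) ^ (0 + 2 * k) =
      (-1) ^ k * (x : ℂ) ^ (2 * k) / (2 * k + 1).factorial := by
    rw [hc, zero_add, pow_mul, neg_sq, mul_pow, Complex.I_sq, mul_pow, ← pow_mul]; ring
  simp only [modSphBessel, ht]
  by_cases hx : x = 0
  · subst hx
    rw [tsum_eq_single 0]
    · simp
    · intro k hk; simp [hk]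
  · have hx' : (x : ℂ) ≠ 0 := by exact_mod_cast hx
    rw [Real.sinc_of_ne_zero hx]
    push_cast
    have := (Complex.hasSum_sin (x : ℂ)).div_const (x : ℂ)
    rw [← this.tsum_eq]
    congr 1
    funext k
    rw [pow_succ]; field_simp

/-- Integrate the expansion against the constant 1: degrees `ℓ ≥ 1` integrate to zero, and degree 0
contributes `4π i_0 = 4π sinc`. -/
theorem integral_planeWave {wl : ℝ} (hwl : 0 < wl) (Y : E3) :
    ∫ p, planeWave (2 * Real.pi / wl) Y p * (Real.sin p.2 : ℂ) ∂angleMeasure =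
      4 * Real.pi * Real.sinc (2 * Real.pi / wl * ‖Y‖) := by
  have h := hasSum_integral_planeWaveTerm (2 * Real.pi / wl) (Q := fun _ => 1) continuous_const Y
  simp only [one_mul] at h
  rw [← h.tsum_eq, tsum_eq_single 0]
  · simp only [planeWaveTerm, legendreP, mul_assoc]
    rw [integral_const_mul, integral_const_mul, integral_const_mul, integral_sin_angleMeasure,
      modSphBessel_zero]
    simp
    ring
  · intro ℓ hℓ
    have := sum_conj_steering_mul_integral hwl (Q := fun _ => 1) continuous_const Y ℓ
    simp only [one_mul, integral_sphHarmonic_mul_sin hℓ, mul_zero, Finset.sum_const_zero] at this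
    exact this.symm

/-! ### The far-field approximation -/

theorem norm_exp_sub_exp_le (a b : ℝ) :
    ‖Complex.exp (-Complex.I * a) - Complex.exp (-Complex.I * b)‖ ≤ |a - b| := by
  have e : Complex.exp (-Complex.I * a) - Complex.exp (-Complex.I * b) =
      Complex.exp (Complex.I * (-b : ℝ)) * (Complex.exp (Complex.I * (b - a : ℝ)) - 1) := by
    rw [mul_sub, ← Complex.exp_add, mul_one]
    congr 2 <;> push_cast <;> ring
  rw [e, norm_mul, Complex.norm_exp_I_mul_ofReal, one_mul, abs_sub_comm]
  exact Real.norm_exp_I_mul_ofReal_sub_one_le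

/-- With `d` the distance and `c = ⟨X, a⟩`, `(d - (r - c)) (d + (r - c)) = ‖X‖² - c²`, and the
second factor is at least `r` because `d ≥ r/2` and `c ≤ r/2`. -/
theorem abs_norm_sub_sub_le {X a : E3} {r : ℝ} (hr : 0 < r) (ha : ‖a‖ = 1) (hX : ‖X‖ ≤ r / 2) :
    |dist X (r • a) - (r - inner ℝ X a)| ≤ ‖X‖ ^ 2 / r := by
  set c : ℝ := inner ℝ X a with hc
  have hc' : |c| ≤ ‖X‖ := by simpa [ha] using abs_real_inner_le_norm X a
  have hd : dist X (r • a) ^ 2 = ‖X‖ ^ 2 - 2 * r * c + r ^ 2 := by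
    rw [dist_eq_norm, norm_sub_sq_real, inner_smul_right, norm_smul, ha, Real.norm_of_nonneg hr.le]
    ring
  have hd1 : r / 2 ≤ dist X (r • a) := by
    have := norm_sub_norm_le (r • a) X
    rw [norm_smul, ha, Real.norm_of_nonneg hr.le, mul_one] at this
    rw [dist_comm, dist_eq_norm]; linarith
  have hc1 := abs_le.mp hc'
  have hs : (dist X (r • a) - (r - c)) * (dist X (r • a) + (r - c)) = ‖X‖ ^ 2 - c ^ 2 := by
    linear_combination hd
  have hcsq : c ^ 2 ≤ ‖X‖ ^ 2 := sq_le_sq' hc1.1 hc1.2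
  have hpos : r ≤ dist X (r • a) + (r - c) := by linarith
  rw [le_div_iff₀ hr]
  calc |dist X (r • a) - (r - c)| * r
      ≤ |dist X (r • a) - (r - c)| * (dist X (r • a) + (r - c)) := by gcongr
    _ = |‖X‖ ^ 2 - c ^ 2| := by
        rw [← hs, abs_mul, abs_of_pos (show 0 < dist X (r • a) + (r - c) by linarith)]
    _ ≤ ‖X‖ ^ 2 := by rw [abs_of_nonneg (by linarith)]; linarith [sq_nonneg c]

/-- The far-field approximation of a spherical wave by a plane wave. -/
theorem norm_sphericalWave_sub_planeWave_le {X a : E3} {r k : ℝ} (hr : 0 < r) (hk : 0 ≤ k)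
    (ha : ‖a‖ = 1) (hX : ‖X‖ ≤ r / 2) :
    ‖((r / dist X (r • a) : ℝ) : ℂ) * Complex.exp (-Complex.I * (k * dist X (r • a) : ℝ)) -
      Complex.exp (-Complex.I * (k * (r - inner ℝ X a) : ℝ))‖ ≤
      2 * ‖X‖ / r + k * (‖X‖ ^ 2 / r) := by
  set d := dist X (r • a) with hd
  have hra : ‖r • a‖ = r := by rw [norm_smul, ha, Real.norm_of_nonneg hr.le, mul_one]
  have hd1 : r / 2 ≤ d := by
    have := norm_sub_norm_le (r • a) X
    rw [hra] at this
    rw [hd, dist_comm, dist_eq_norm]; linarith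
  have hd2 : |r - d| ≤ ‖X‖ := by
    have := abs_norm_sub_norm_le (r • a) (r • a - X)
    rw [hra, sub_sub_cancel] at this
    rwa [hd, dist_comm, dist_eq_norm]
  have hdpos : 0 < d := by linarith
  -- Amplitude error plus phase error: the first is at most `‖X‖ / (r/2)`, the second at most `k`
  -- times the path-length error.
  have e : ((r / d : ℝ) : ℂ) * Complex.exp (-Complex.I * (k * d : ℝ)) -
      Complex.exp (-Complex.I * (k * (r - inner ℝ X a) : ℝ)) =
      (((r - d) / d : ℝ) : ℂ) * Complex.exp (-Complex.I * (k * d : ℝ)) +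
      (Complex.exp (-Complex.I * (k * d : ℝ)) -
        Complex.exp (-Complex.I * (k * (r - inner ℝ X a) : ℝ))) := by
    have : (r - d) / d = r / d - 1 := by field_simp
    rw [this]; push_cast; ring
  rw [e]
  refine (norm_add_le _ _).trans (add_le_add ?_ ?_)
  · have h1 : ‖Complex.exp (-Complex.I * (k * d : ℝ))‖ = 1 := by rw [Complex.norm_exp]; simp
    rw [norm_mul, h1, mul_one, Complex.norm_real, Real.norm_eq_abs, abs_div, abs_of_pos hdpos,
      div_le_div_iff₀ hdpos hr]
    nlinarith [norm_nonneg X, abs_nonneg (r - d)]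
  · refine (norm_exp_sub_exp_le _ _).trans ?_
    rw [← mul_sub, abs_mul, abs_of_nonneg hk]
    gcongr
    exact abs_norm_sub_sub_le hr ha hX

/-! ### The noiseless signal and the error constant -/

theorem sphPoint_eq_smul (r φ θ : ℝ) : sphPoint r φ θ = r • sphPoint 1 φ θ := by
  ext i; fin_cases i <;> simp [sphPoint]

theorem half_le_dist_sphPoint {r : ℝ} (hr : 0 < r) {X : E3} (hX : ‖X‖ ≤ r / 2) (φ θ : ℝ) :
    r / 2 ≤ dist X (sphPoint r φ θ) := by
  have := norm_sub_norm_le (sphPoint r φ θ) X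
  rw [norm_sphPoint, abs_of_pos hr] at this
  rw [dist_comm, dist_eq_norm]; linarith

theorem sphRiemannSum_add (f g : ℝ → ℝ → ℂ) (N : ℕ) :
    sphRiemannSum (fun φ θ => f φ θ + g φ θ) N = sphRiemannSum f N + sphRiemannSum g N := by
  simp only [sphRiemannSum, add_mul, mul_add, Finset.sum_add_distrib]

/-- The noiseless part of the training signal as a function of the angles of the array element. -/
noncomputable def noiselessSignal {U : ℕ} (wl r₀ : ℝ) (X : Fin U → E3) (p : ℝ × ℝ) : ℂ :=
  ((wl / √(4 * Real.pi) : ℝ) : ℂ) * ∑ u, channel wl (X u) (sphPoint r₀ p.1 p.2)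

theorem continuous_channel_sphPoint {wl r₀ : ℝ} (hr : 0 < r₀) {X : E3} (hX : ‖X‖ ≤ r₀ / 2) :
    Continuous fun p : ℝ × ℝ => channel wl X (sphPoint r₀ p.1 p.2) := by
  have h := continuous_sphPoint r₀
  have hpi : √(4 * Real.pi) ≠ 0 := by have := Real.pi_pos; positivity
  unfold channel
  refine Continuous.mul (Complex.continuous_ofReal.comp (Continuous.div₀ (by fun_prop) (by fun_prop)
    fun p => ?_)) (by fun_prop)
  have := half_le_dist_sphPoint hr hX p.1 p.2
  exact mul_ne_zero hpi (by linarith)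

theorem continuous_noiselessSignal {U : ℕ} {wl r₀ : ℝ} (hr : 0 < r₀) {X : Fin U → E3}
    (hX : ∀ u, ‖X u‖ ≤ r₀ / 2) : Continuous (noiselessSignal wl r₀ X) :=
  continuous_const.mul (continuous_finsetSum _ fun u _ => continuous_channel_sphPoint hr (hX u))

theorem tendsto_sphRiemannSum_trainingSignal {U : ℕ} {wl r₀ : ℝ} (hr : 0 < r₀) {X : Fin U → E3}
    (hX : ∀ u, ‖X u‖ ≤ r₀ / 2) {noise : E3 → ℂ} {ℓ : ℕ} {m : ℤ} (hm : -(ℓ : ℤ) ≤ m)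
    (hnoise : Tendsto (sphRiemannSum (laplaceIntegrand r₀ noise ℓ m)) atTop (𝓝 0)) :
    Tendsto (sphRiemannSum (laplaceIntegrand r₀ (trainingSignal wl X noise) ℓ m)) atTop
      (𝓝 (∫ p, noiselessSignal wl r₀ X p * sphHarmonic ℓ m p.1 p.2 * (Real.sin p.2 : ℂ)
        ∂angleMeasure)) := by
  obtain ⟨G, hGc, hG⟩ := exists_continuous_eq_sphHarmonic hm
  have hQ := continuous_noiselessSignal (wl := wl) hr hX
  have h1 := tendsto_sphRiemannSum
    (f := fun φ θ => noiselessSignal wl r₀ X (φ, θ) * sphHarmonic ℓ m φ θ)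
    (G := fun p => noiselessSignal wl r₀ X p * G p) (by fun_prop)
    (fun φ θ h0 hπ => by rw [hG φ θ h0 hπ])
  have h2 : ∫ p, noiselessSignal wl r₀ X p * G p * (Real.sin p.2 : ℂ) ∂angleMeasure =
      ∫ p, noiselessSignal wl r₀ X p * sphHarmonic ℓ m p.1 p.2 * (Real.sin p.2 : ℂ)
        ∂angleMeasure := by
    refine integral_congr_ae ?_
    filter_upwards [ae_angleMeasure] with p hp
    rw [hG _ _ hp.1 hp.2]
  rw [h2] at h1
  have h3 := h1.add hnoise
  rw [add_zero] at h3
  refine h3.congr fun N => ?_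
  rw [← sphRiemannSum_add]
  congr 1
  funext φ θ
  simp only [laplaceIntegrand, trainingSignal, noiselessSignal]
  ring

theorem mul_noiselessSignal_eq {U : ℕ} {wl : ℝ} (hwl : 0 < wl) (r₀ : ℝ) (X : Fin U → E3)
    (p : ℝ × ℝ) :
    ((r₀ / wl : ℝ) : ℂ) * noiselessSignal wl r₀ X p = (1 / (4 * Real.pi) : ℂ) *
      ∑ u, ((r₀ / dist (X u) (r₀ • sphPoint 1 p.1 p.2) : ℝ) : ℂ) *
        Complex.exp (-Complex.I * (2 * Real.pi / wl * dist (X u) (r₀ • sphPoint 1 p.1 p.2) : ℝ)) := by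
  have hpi := Real.pi_pos
  rw [noiselessSignal, Finset.mul_sum, Finset.mul_sum, Finset.mul_sum]
  refine Finset.sum_congr rfl fun u _ => ?_
  rw [channel, ← sphPoint_eq_smul]
  have h : (r₀ / wl) * (wl / √(4 * Real.pi) *
      (1 / (√(4 * Real.pi) * dist (X u) (sphPoint r₀ p.1 p.2)))) =
      1 / (4 * Real.pi) * (r₀ / dist (X u) (sphPoint r₀ p.1 p.2)) := by
    have hs : √(4 * Real.pi) * √(4 * Real.pi) = 4 * Real.pi := Real.mul_self_sqrt (by positivity)
    have : r₀ / wl * (wl / √(4 * Real.pi) *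
      (1 / (√(4 * Real.pi) * dist (X u) (sphPoint r₀ p.1 p.2)))) = (wl / wl) *
        (1 / (√(4 * Real.pi) * √(4 * Real.pi))) * (r₀ / dist (X u) (sphPoint r₀ p.1 p.2)) := by
      ring
    rw [this, hs, div_self hwl.ne', one_mul]
  have h' := congrArg (fun y : ℝ => (y : ℂ)) h
  push_cast at h' ⊢
  linear_combination Complex.exp (-Complex.I *
    (2 * Real.pi / wl * dist (X u) (sphPoint r₀ p.1 p.2))) * h'

theorem abs_norm_integral_sub_le {U : ℕ} {wl R r₀ : ℝ} (hwl : 0 < wl) (hr : 0 < r₀)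
    {X : Fin U → E3} (hR : ∀ u, ‖X u‖ ≤ R) (hX : ∀ u, ‖X u‖ ≤ r₀ / 2) (Y : E3) :
    |r₀ / wl * ‖∫ p, noiselessSignal wl r₀ X p * planeWave (2 * Real.pi / wl) Y p *
        (Real.sin p.2 : ℂ) ∂angleMeasure‖ -
      (|∑ u, Real.sinc (2 * Real.pi / wl * dist Y (X u))|)| ≤
      U * (Real.pi / 2 * (2 + 2 * Real.pi / wl * R)) * ((⨆ u, ‖X u‖) / r₀) := by
  have hpi := Real.pi_pos
  set k : ℝ := 2 * Real.pi / wl with hk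
  have hk0 : 0 ≤ k := by positivity
  set M : ℝ := ⨆ u, ‖X u‖ with hM
  have hXM (u) : ‖X u‖ ≤ M := le_ciSup (Set.finite_range fun u => ‖X u‖).bddAbove u
  set S : ℂ := ∫ p, noiselessSignal wl r₀ X p * planeWave k Y p * (Real.sin p.2 : ℂ) ∂angleMeasure
    with hS
  -- The phase common to all users, of modulus 1, removed by the outer absolute values.
  set c : ℂ := Complex.exp (-Complex.I * (k * r₀ : ℝ)) with hc
  have hcn : ‖c‖ = 1 := by rw [hc, Complex.norm_exp]; simp
  let E : Fin U → ℝ × ℝ → ℂ := fun u p =>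
    Complex.exp (-Complex.I * (k * (r₀ - inner ℝ (X u) (sphPoint 1 p.1 p.2)) : ℝ))
  have hEc (u) : Continuous (E u) := by
    have := continuous_sphPoint 1
    fun_prop
  have hE (u) : ∫ p, E u p * planeWave k Y p * (Real.sin p.2 : ℂ) ∂angleMeasure =
      c * (4 * Real.pi * Real.sinc (k * dist Y (X u))) := by
    rw [dist_eq_norm, ← integral_planeWave hwl, ← integral_const_mul]
    congr 1
    funext p
    rw [planeWave_sub, ← mul_assoc, ← mul_assoc, hc, ← Complex.exp_add]
    simp only [E, ← hk]
    congr 3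
    push_cast; ring
  have hQc := continuous_noiselessSignal (wl := wl) hr hX
  have hPc := continuous_planeWave k Y
  have hdiff : ((r₀ / wl : ℝ) : ℂ) * S - c * (∑ u, Real.sinc (k * dist Y (X u)) : ℝ) =
      ∫ p, (((r₀ / wl : ℝ) : ℂ) * noiselessSignal wl r₀ X p - (1 / (4 * Real.pi) : ℂ) * ∑ u, E u p) *
        planeWave k Y p * (Real.sin p.2 : ℂ) ∂angleMeasure := by
    have e1 : ((r₀ / wl : ℝ) : ℂ) * S = ∫ p, ((r₀ / wl : ℝ) : ℂ) *
        (noiselessSignal wl r₀ X p * planeWave k Y p * (Real.sin p.2 : ℂ)) ∂angleMeasure := by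
      rw [integral_const_mul]
    have e2 : c * (∑ u, Real.sinc (k * dist Y (X u)) : ℝ) = ∫ p, (1 / (4 * Real.pi) : ℂ) *
        ∑ u, E u p * planeWave k Y p * (Real.sin p.2 : ℂ) ∂angleMeasure := by
      rw [integral_const_mul, integral_finsetSum _ fun u _ => integrable_angleMeasure (by
        have := hEc u
        fun_prop)]
      simp only [hE]
      rw [← Finset.mul_sum, ← Finset.mul_sum]
      push_cast
      field_simp
    rw [e1, e2, ← integral_sub]
    · congr 1
      funext p
      rw [sub_mul, sub_mul, mul_assoc (1 / (4 * Real.pi) : ℂ), mul_assoc (1 / (4 * Real.pi) : ℂ),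
        Finset.sum_mul, Finset.sum_mul]
      ring
    · exact integrable_angleMeasure (by fun_prop)
    · exact integrable_angleMeasure (by fun_prop)
  have hbound (p : ℝ × ℝ) : ‖(((r₀ / wl : ℝ) : ℂ) * noiselessSignal wl r₀ X p -
      (1 / (4 * Real.pi) : ℂ) * ∑ u, E u p) * planeWave k Y p * (Real.sin p.2 : ℂ)‖ ≤
      1 / (4 * Real.pi) * (U * ((2 + k * R) * (M / r₀))) := by
    have ha : ‖sphPoint 1 p.1 p.2‖ = 1 := by rw [norm_sphPoint, abs_one]
    have h4 : ‖(1 / (4 * Real.pi) : ℂ)‖ = 1 / (4 * Real.pi) := by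
      have : (1 / (4 * Real.pi) : ℂ) = ((1 / (4 * Real.pi) : ℝ) : ℂ) := by push_cast; rfl
      rw [this, Complex.norm_real, Real.norm_of_nonneg (by positivity)]
    rw [mul_noiselessSignal_eq hwl, ← mul_sub, ← Finset.sum_sub_distrib, norm_mul, norm_mul,
      norm_planeWave, mul_one, norm_mul, h4, Complex.norm_real]
    have hterm (u : Fin U) : ‖((r₀ / dist (X u) (r₀ • sphPoint 1 p.1 p.2) : ℝ) : ℂ) *
        Complex.exp (-Complex.I * (k * dist (X u) (r₀ • sphPoint 1 p.1 p.2) : ℝ)) - E u p‖ ≤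
        (2 + k * R) * (M / r₀) := by
      refine (norm_sphericalWave_sub_planeWave_le hr hk0 ha (hX u)).trans ?_
      have hR0 : 0 ≤ R := (norm_nonneg _).trans (hR u)
      calc 2 * ‖X u‖ / r₀ + k * (‖X u‖ ^ 2 / r₀) = (2 + k * ‖X u‖) * (‖X u‖ / r₀) := by ring
        _ ≤ (2 + k * R) * (M / r₀) := by
          gcongr
          · exact hR u
          · exact hXM u
    have hsum : ‖∑ u, (((r₀ / dist (X u) (r₀ • sphPoint 1 p.1 p.2) : ℝ) : ℂ) *
        Complex.exp (-Complex.I * (k * dist (X u) (r₀ • sphPoint 1 p.1 p.2) : ℝ)) - E u p)‖ ≤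
        U * ((2 + k * R) * (M / r₀)) := by
      refine (norm_sum_le_of_le _ fun u _ => hterm u).trans_eq ?_
      simp
    have hs : ‖Real.sin p.2‖ ≤ 1 := Real.abs_sin_le_one _
    calc _ ≤ 1 / (4 * Real.pi) * (U * ((2 + k * R) * (M / r₀))) * 1 := by
          gcongr
          -- Nonnegativity is read off from `hsum`, since without users `R` may be negative.
          exact mul_nonneg (by positivity) ((norm_nonneg _).trans hsum)
      _ = _ := mul_one _
  have hint := norm_integral_le_of_norm_le_const (μ := angleMeasure) (ae_of_all _ hbound)
  rw [← hdiff, measureReal_angleMeasure] at hint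
  have n1 : r₀ / wl * ‖S‖ = ‖((r₀ / wl : ℝ) : ℂ) * S‖ := by
    rw [norm_mul, Complex.norm_real, Real.norm_of_nonneg (by positivity)]
  have n2 : |∑ u, Real.sinc (k * dist Y (X u))| =
      ‖c * (∑ u, Real.sinc (k * dist Y (X u)) : ℝ)‖ := by
    rw [norm_mul, hcn, one_mul, Complex.norm_real, Real.norm_eq_abs]
  rw [n1, n2]
  refine (abs_norm_sub_norm_le _ _).trans (hint.trans_eq ?_)
  field_simp
  ring

end SphericalArray

/-! ### The main theorem -/

theorem mainTheorem3 (U : ℕ) (wl R : ℝ) (hwl : 0 < wl) :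
    ∃ C : ℝ, ∀ (r₀ : ℝ) (X : Fin U → SphericalArray.E3) (σ : NNReal)
      (Ω : Type*) [MeasurableSpace Ω] (μ : Measure Ω) [IsProbabilityMeasure μ]
      (z : SphericalArray.E3 → Ω → ℂ),
      0 < r₀ →
      (∀ u, ‖X u‖ ≤ R) →
      (∀ u, ‖X u‖ ≤ r₀ / 2) →
      (∀ A ∈ Metric.sphere (0 : SphericalArray.E3) r₀,
        HasLaw (z A) (SphericalArray.complexGaussian (σ ^ 2)) μ) →
      (∀ A ∈ Metric.sphere (0 : SphericalArray.E3) r₀,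
        ∀ B ∈ Metric.sphere (0 : SphericalArray.E3) r₀,
          A ≠ B → IndepFun (z A) (z B) μ) →
      ∀ᵐ ω ∂μ,
        (∀ (ℓ : ℕ) (m : ℤ), -(ℓ : ℤ) ≤ m → m ≤ ℓ →
          Tendsto
            (SphericalArray.sphRiemannSum
              (SphericalArray.laplaceIntegrand r₀
                (SphericalArray.trainingSignal wl X (fun A => z A ω)) ℓ m))
            atTop
            (𝓝 (SphericalArray.laplaceCoeff r₀
              (SphericalArray.trainingSignal wl X (fun A => z A ω)) ℓ m))) ∧
        ∀ Y : SphericalArray.E3,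
          Summable (SphericalArray.profileTerm wl r₀
            (SphericalArray.trainingSignal wl X (fun A => z A ω)) Y) ∧
          |SphericalArray.profile wl r₀
              (SphericalArray.trainingSignal wl X (fun A => z A ω)) Y -
            (|∑ u, Real.sinc (2 * Real.pi / wl * dist Y (X u))|)| ≤
          C * ((⨆ u, ‖X u‖) / r₀) := by
  have hpi := Real.pi_pos
  -- Far-field error `2 + k R` per user, times `1 / (4π)` from the signal, times the area `2π²` of
  -- the angle rectangle, with `sin θ` bounded by 1.
  refine ⟨U * (Real.pi / 2 * (2 + 2 * Real.pi / wl * R)), ?_⟩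
  intro r₀ X σ Ω _ μ _ z hr hR hX hlaw hind
  -- One null set for all `(ℓ, m)`, chosen before `Y`.
  have hnoise : ∀ᵐ ω ∂μ, ∀ (ℓ : ℕ) (m : ℤ), -(ℓ : ℤ) ≤ m →
      Tendsto (SphericalArray.sphRiemannSum
        (SphericalArray.laplaceIntegrand r₀ (fun A => z A ω) ℓ m)) atTop (𝓝 0) := by
    rw [ae_all_iff]; intro ℓ
    rw [ae_all_iff]; intro m
    by_cases hm : -(ℓ : ℤ) ≤ m
    · filter_upwards [SphericalArray.ae_tendsto_sphRiemannSum_noise hr hlaw hind hm] with ω hω _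
      exact hω
    · exact ae_of_all _ fun ω h => absurd h hm
  filter_upwards [hnoise] with ω hω
  have hlim (ℓ : ℕ) (m : ℤ) (hm : -(ℓ : ℤ) ≤ m) :=
    SphericalArray.tendsto_sphRiemannSum_trainingSignal (wl := wl) hr hX hm (hω ℓ m hm)
  have hcoeff (ℓ : ℕ) (m : ℤ) (hm : -(ℓ : ℤ) ≤ m) : SphericalArray.laplaceCoeff r₀
      (SphericalArray.trainingSignal wl X (fun A => z A ω)) ℓ m = _ := (hlim ℓ m hm).limUnder_eq
  refine ⟨fun ℓ m hm _ => by rw [hcoeff ℓ m hm]; exact hlim ℓ m hm, fun Y => ?_⟩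
  have hQ := SphericalArray.continuous_noiselessSignal (wl := wl) hr hX
  have hterm : SphericalArray.profileTerm wl r₀
      (SphericalArray.trainingSignal wl X (fun A => z A ω)) Y = fun ℓ =>
      ∫ p, SphericalArray.noiselessSignal wl r₀ X p *
        SphericalArray.planeWaveTerm (2 * Real.pi / wl) Y ℓ p * (Real.sin p.2 : ℂ)
        ∂SphericalArray.angleMeasure := by
    funext ℓ
    rw [SphericalArray.profileTerm, ← SphericalArray.sum_conj_steering_mul_integral hwl hQ Y ℓ]
    exact Finset.sum_congr rfl fun m hm => by rw [hcoeff ℓ m (Finset.mem_Icc.mp hm).1]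
  have hsum := SphericalArray.hasSum_integral_planeWaveTerm (2 * Real.pi / wl) hQ Y
  rw [SphericalArray.profile, hterm]
  -- Summability in `ℂ` is absolute convergence.
  refine ⟨hsum.summable, ?_⟩
  rw [hsum.tsum_eq]
  exact SphericalArray.abs_norm_integral_sub_le hwl hr hR hX Y
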